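/- Let $V$ be the universe of sets and let $W\subseteq V$ be an inner model of $\mathsf{ZFC}$, i.e. a transitive class that contains all ordinals and satisfies $\mathsf{ZFC}$. For infinite regular cardinals $\lambda<\kappa$, a $\lambda$-covering matrix for $\kappa$ is a family $\mathcal D=(K(\alpha,\beta):\alpha<\lambda,\ \beta<\kappa)$ of subsets of $\kappa$ such that: (i) $\beta\subseteq\bigcup_{\alpha<\lambda}K(\alpha,\beta)$ for all $\beta<\kappa$; (ii) $|K(\alpha,\beta)|<\kappa$ for all $\alpha,\beta$; (iii) $K(\alpha,\beta)\subseteq K(\eta,\beta)$ for all $\beta<\kappa$ and $\alpha<\eta<\lambda$; (iv) for all $\gamma<\beta<\kappa$ and $\alpha<\lambda$ there is $\eta<\lambda$ with $K(\alpha,\gamma)\subseteq K(\eta,\beta)$; (v) for every $X\subseteq\kappa$ with $|X|\le\lambda$ there is $\gamma_X<\kappa$ such that for all $\beta<\kappa$ and $\eta<\lambda$ there is $\alpha<\lambda$ with $K(\eta,\beta)\cap X\subseteq K(\alpha,\gamma_X)$. $\mathsf{CP}(\kappa,\lambda)$ says that for every $\lambda$-covering matrix $\mathcal D$ for $\kappa$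 there is an unbounded $A\subseteq\kappa$ such that every $X\subseteq A$ of size $\lambda$ is contained in some $K(\alpha,\beta)$. $\mathsf{CP}$ says that $\mathsf{CP}(\kappa,\omega)$ holds for every regular $\kappa>\mathfrak c$. **Proposition.** Assume that $\mathsf{CP}$ holds in $V$. Let $\kappa$ be the least cardinal of $W$ such that there is a function $f:\omega\to\kappa$ in $V$ with $f\notin W$. Assume that $\kappa>\mathfrak c$, that $(\kappa^+)^W=\kappa^+$ (where $\kappa^+$ and $\mathfrak c$ are computed in $V$), and that every countably infinite subset of any ordinal $\mu<\kappa$ belongs to $W$. Then for every infinite regular cardinal $\lambda<\kappa$ of $V$ there is a set $S\in W$ with $$S\subseteq (S^{\lambda}_{\kappa^+})^W=\{\alpha<\kappa^+ : W\models \mathrm{cof}(\alpha)=\lambda\}$$ such that $S$ is stationary in $W$ (it meets every club $C\subseteq\kappa^+$ with $C\in W$), but $S$ is not stationary in $V$ (it is disjoint from some club subset of $\kappa^+$ in $V$). -/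

import Mathlib

universe u

/-! ## Covering matrices and the covering property, in the universe of sets -/

namespace Covering

open Cardinal Set

/-- `K` is a `lam`-covering matrix for `kap`; only the entries `K α β` with `α < lam` and
`β < kap` (as ordinals) matter. The sets of ordinals below live in `Type (u + 1)`, hence the
cardinal lifts. -/
structure IsCoveringMatrix (lam kap : Cardinal.{u})
    (K : Ordinal.{u} → Ordinal.{u} → Set Ordinal.{u}) : Prop where
  subset : ∀ α < lam.ord, ∀ β < kap.ord, K α β ⊆ Iio kap.ord
  covers : ∀ β < kap.ord, ∀ ξ < β, ∃ α < lam.ord, ξ ∈ K α β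
  small : ∀ α < lam.ord, ∀ β < kap.ord, #(K α β) < Cardinal.lift.{u + 1} kap
  mono : ∀ β < kap.ord, ∀ α η, α < η → η < lam.ord → K α β ⊆ K η β
  upward : ∀ γ β, γ < β → β < kap.ord → ∀ α < lam.ord, ∃ η < lam.ord, K α γ ⊆ K η β
  coherent : ∀ X ⊆ Iio kap.ord, #X ≤ Cardinal.lift.{u + 1} lam →
    ∃ γ < kap.ord, ∀ β < kap.ord, ∀ η < lam.ord, ∃ α < lam.ord, K η β ∩ X ⊆ K α γ

/-- `CP(kap, lam)`: for every `lam`-covering matrix `K` for `kap` there is an unbounded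
`A ⊆ kap` such that every `X ∈ [A]^lam` is contained in some entry of `K`. -/
def HasCP (kap lam : Cardinal.{u}) : Prop :=
  ∀ K : Ordinal.{u} → Ordinal.{u} → Set Ordinal.{u}, IsCoveringMatrix lam kap K →
    ∃ A ⊆ Iio kap.ord, (∀ β < kap.ord, ∃ ξ ∈ A, β ≤ ξ) ∧
      ∀ X ⊆ A, #X = Cardinal.lift.{u + 1} lam →
        ∃ α < lam.ord, ∃ β < kap.ord, X ⊆ K α β

/-- The covering property `CP`: `CP(kap, ω)` holds for all regular `kap > 𝔠`. -/
def CP : Prop :=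
  ∀ kap : Cardinal.{u}, kap.IsRegular → 𝔠 < kap → HasCP kap ℵ₀

end Covering

/-! ## Inner models -/

namespace InnerModel

/-- The only symbol of the language of set theory: a binary relation symbol. -/
inductive MemRel : ℕ → Type
  | mem : MemRel 2

/-- The first-order language of set theory. -/
def setLang : FirstOrder.Language.{0, 0} :=
  ⟨fun _ => Empty, MemRel⟩

/-- A class `W` of sets, with the membership relation, as a structure `(W, ∈)`. -/
instance memStructure (W : Set ZFSet.{u}) : setLang.Structure W where
  funMap := fun f => Empty.elim f
  RelMap := fun {_} r => match r with
    | MemRel.mem => fun v => (v 0).1 ∈ (v 1).1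

/-- `(W, ∈)` satisfies `ZFC`. In the two schemes, `D` and `R` run through the classes of `(W, ∈)`
that are first-order definable over `(W, ∈)` with parameters from `W`. -/
structure SatisfiesZFC (W : Set ZFSet.{u}) : Prop where
  extensionality : ∀ x y : W, (∀ z : W, z.1 ∈ x.1 ↔ z.1 ∈ y.1) → x = y
  foundation : ∀ x : W, (∃ y : W, y.1 ∈ x.1) →
    ∃ y : W, y.1 ∈ x.1 ∧ ∀ z : W, ¬ (z.1 ∈ x.1 ∧ z.1 ∈ y.1)
  pairing : ∀ x y : W, ∃ p : W, ∀ z : W, z.1 ∈ p.1 ↔ z = x ∨ z = y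
  union : ∀ x : W, ∃ y : W, ∀ z : W, z.1 ∈ y.1 ↔ ∃ t : W, z.1 ∈ t.1 ∧ t.1 ∈ x.1
  powerset : ∀ x : W, ∃ y : W, ∀ z : W, z.1 ∈ y.1 ↔ ∀ t : W, t.1 ∈ z.1 → t.1 ∈ x.1
  infinity : ∃ x : W, (∃ e : W, e.1 ∈ x.1 ∧ ∀ z : W, z.1 ∉ e.1) ∧
    ∀ y : W, y.1 ∈ x.1 → ∃ s : W, s.1 ∈ x.1 ∧ ∀ z : W, z.1 ∈ s.1 ↔ z.1 ∈ y.1 ∨ z = y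
  separation : ∀ D : Set W, (Set.univ : Set W).Definable₁ setLang D →
    ∀ x : W, ∃ y : W, ∀ z : W, z.1 ∈ y.1 ↔ z.1 ∈ x.1 ∧ z ∈ D
  replacement : ∀ R : Set (W × W), (Set.univ : Set W).Definable₂ setLang R →
    ∀ x : W, (∀ z : W, z.1 ∈ x.1 → ∃! t : W, (z, t) ∈ R) →
      ∃ y : W, ∀ t : W, t.1 ∈ y.1 ↔ ∃ z : W, z.1 ∈ x.1 ∧ (z, t) ∈ R
  choice : ∀ x : W, (∀ y : W, y.1 ∈ x.1 → ∃ z : W, z.1 ∈ y.1) →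
    (∀ y y' : W, y.1 ∈ x.1 → y'.1 ∈ x.1 → y ≠ y' → ∀ z : W, ¬ (z.1 ∈ y.1 ∧ z.1 ∈ y'.1)) →
      ∃ c : W, ∀ y : W, y.1 ∈ x.1 → ∃! z : W, z.1 ∈ y.1 ∧ z.1 ∈ c.1

/-- `W` is an inner model: a transitive class that contains all the ordinals and satisfies
`ZFC`. -/
structure IsInnerModel (W : Set ZFSet.{u}) : Prop where
  transitive : ∀ x ∈ W, ∀ y ∈ x, y ∈ W
  ordinals : ∀ α : Ordinal.{u}, α.toZFSet ∈ W
  zfc : SatisfiesZFC W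

/-! ## Notions relativized to a class `W` -/

/-- The set `f` is a bijection of the set `x` with the set `y`. -/
def IsBijection (x y f : ZFSet.{u}) : Prop :=
  ZFSet.IsFunc x y f ∧ ∀ w ∈ y, ∃! z, z ∈ x ∧ ZFSet.pair z w ∈ f

/-- The ordinal `κ` is a cardinal of `W`: no bijection in `W` of a smaller ordinal with `κ`. -/
def IsCardinalIn (W : Set ZFSet.{u}) (κ : Ordinal.{u}) : Prop :=
  ∀ α < κ, ¬ ∃ f ∈ W, IsBijection α.toZFSet κ.toZFSet f

/-- `δ = (κ^+)^W`: `δ` is the least cardinal of `W` above `κ`. -/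
def IsSuccCardinalIn (W : Set ZFSet.{u}) (κ δ : Ordinal.{u}) : Prop :=
  IsLeast {μ | κ < μ ∧ IsCardinalIn W μ} δ

/-- `κ^ω ∖ W` is nonempty: some sequence `ω → κ` is not in `W`. -/
def HasNewSequence (W : Set ZFSet.{u}) (κ : Ordinal.{u}) : Prop :=
  ∃ f, ZFSet.IsFunc Ordinal.omega0.toZFSet κ.toZFSet f ∧ f ∉ W

/-- Some function in `W` from the ordinal `γ` to the ordinal `α` has cofinal range. -/
def HasCofinalMapIn (W : Set ZFSet.{u}) (γ α : Ordinal.{u}) : Prop :=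
  ∃ f ∈ W, ZFSet.IsFunc γ.toZFSet α.toZFSet f ∧
    ∀ ξ < α, ∃ η < γ, ∃ ζ < α, ξ ≤ ζ ∧ ZFSet.pair η.toZFSet ζ.toZFSet ∈ f

/-- `cof(α) = γ` in `W`. -/
def HasCofinalityIn (W : Set ZFSet.{u}) (α γ : Ordinal.{u}) : Prop :=
  IsLeast {γ' | HasCofinalMapIn W γ' α} γ

/-- The set of ordinals below `δ` that belong to the set `x`, as a subset of the order `δ`. -/
def trace (δ : Ordinal.{u}) (x : ZFSet.{u}) : Set (Set.Iio δ) :=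
  {ξ | ξ.1.toZFSet ∈ x}

/-- The set `S` is a stationary subset of `δ` in the sense of `W`: it is in `W`, it is a subset
of `δ`, and it meets every club subset of `δ` that is in `W`. -/
def IsStationaryIn (W : Set ZFSet.{u}) (δ : Ordinal.{u}) (S : ZFSet.{u}) : Prop :=
  S ∈ W ∧ S ⊆ δ.toZFSet ∧
    ∀ C ∈ W, C ⊆ δ.toZFSet → IsClub (trace δ C) → (trace δ S ∩ trace δ C).Nonempty

end InnerModel

/-!
The proof is by contradiction: if every set of `W` that is stationary in `W` and consists of
points of `W`-cofinality `λ` were stationary in the universe, then every sequence `s : ω → κ`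
would be in `W`.

Choose in `W` partial functions `E β` of `κ` onto the ordinals `β < κ⁺`, which is possible because
`κ⁺` is the successor cardinal of `κ` in `W` (`exists_enumerations`). A new sequence `s` is
cofinal in `κ`, since countable subsets of smaller ordinals are in `W`; let `g : ω → κ` be
monotone and cofinal. The `k`-th entry of the covering matrix at `β` is the set
`Hull W E (g k) β`, the least set that contains, for `γ = β` and for each of its own elements `γ`, the ordinals
that `E γ` lists up to `g k`. It is a set of `W`, of size at most `g k` in `W` (`covered_hull`),
and closing off makes the matrix upward coherent; the remaining property of a covering matrix
holds since a countable set has only `𝔠 < κ⁺` subsets (`isCoveringMatrix_hullMatrix`). So the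
covering property gives an unbounded `A ⊆ κ⁺` whose countable subsets are included in entries of
the matrix, and the same follows for its subsets of size `λ`, because `λ^ω ≤ κ`
(`exists_unbounded_of_CP`, `mk_seq_le`).

For `i < κ`, let `U α` be the set of the points `β > α` of `W`-cofinality `λ` with `E β i = α`;
these are pairwise disjoint. The set of all points of `W`-cofinality `λ` is stationary in `W`,
hence in the universe by the assumption, and Ulam's argument in the universe gives an `i` for
which unboundedly many `U α` are stationary (`exists_ulam`). The `α` with `U α` stationary in `W`
form a definable class, whose collapse `ρ` is onto `κ⁺` (`exists_collapse`,
`collapse_surjective`), so `s k = ρ (α k)` for some such `α k`. By the assumption again, `U (α k)`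
is stationary in the universe, so that it has a point `β k` that is a limit of `A`. A set `X ⊆ A`
of size `λ`, cofinal in all `β k` and reaching above them, is included in a hull `H`. Then `β k`
is the supremum of the elements of `H` below the least element `ξ k` of `H` that is not below
`β k`. As `H` has size at most `g m < κ` in `W`, the sequence of the `ξ k` is coded by a sequence in
`g m`, which is in `W`. From it `W` computes `β k`, then `α k` as the value `E (β k) i`, and then
`s k`: a contradiction.

All this is carried out with classes of ordinals that are first-order definable over `(W, ∈)`. The
type class `Dfn` lets instance search verify definability, and comprehension (`exists_rel`,
`exists_orel`) turns bounded definable classes into sets of `W`. The set theory of `W` that is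
needed is definability by recursion (`dfn_recursion`), the well-ordering theorem (`exists_enum`)
and Hessenberg's theorem (`exists_pairing`).
-/

namespace InnerModel

open Set FirstOrder FirstOrder.Language

/-! ### Classes definable over `(W, ∈)` -/

variable {W : Set ZFSet.{u}}

/-- A class of `n`-tuples from `W` is definable over `(W, ∈)` with parameters. This is a type class
so that instance search builds the formula from the syntax of `P`. -/
class Dfn {n : ℕ} (P : (Fin n → W) → Prop) : Prop where
  out : (univ : Set W).Definable setLang {v | P v}

/-- `t` is given by a term. The language has no function symbols, so `t` is a variable or a constant
of `W`. -/
class Tm {n : ℕ} (t : (Fin n → W) → W) : Prop where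
  out : ∃ τ : (setLang[[(univ : Set W)]]).Term (Fin n), ∀ v, τ.realize v = t v

variable {n : ℕ}

instance Tm.var (i : Fin n) : Tm (W := W) (fun v => v i) := ⟨Term.var i, fun _ => rfl⟩

instance Tm.const (c : W) : Tm (n := n) (fun _ => c) :=
  ⟨(setLang.con (⟨c, mem_univ c⟩ : (univ : Set W))).term, fun v => by simp⟩

theorem Dfn.congr {P Q : (Fin n → W) → Prop} (hP : Dfn P) (h : ∀ v, Q v ↔ P v) : Dfn Q :=
  ⟨by simpa only [h] using hP.out⟩

instance Dfn.mem (t s : (Fin n → W) → W) [ht : Tm t] [hs : Tm s] :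
    Dfn (fun v => (t v).1 ∈ (s v).1) := by
  obtain ⟨τ, hτ⟩ := ht.out
  obtain ⟨σ, hσ⟩ := hs.out
  let R : (setLang[[(univ : Set W)]]).Relations 2 := Sum.inl MemRel.mem
  refine ⟨R.formula₂ τ σ, ?_⟩
  ext v
  have h : (R.formula₂ τ σ).Realize v ↔ (τ.realize v).1 ∈ (σ.realize v).1 :=
    Formula.realize_rel₂
  simp only [Set.mem_ofPred_eq, ← hτ, ← hσ]
  exact h.symm

instance Dfn.eq (t s : (Fin n → W) → W) [ht : Tm t] [hs : Tm s] :
    Dfn (fun v => t v = s v) := by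
  obtain ⟨τ, hτ⟩ := ht.out
  obtain ⟨σ, hσ⟩ := hs.out
  refine ⟨τ.equal σ, ?_⟩
  ext v
  simp [← hτ, ← hσ]

instance Dfn.and (P Q : (Fin n → W) → Prop) [hP : Dfn P] [hQ : Dfn Q] :
    Dfn (fun v => P v ∧ Q v) := ⟨hP.out.inter hQ.out⟩

instance Dfn.or (P Q : (Fin n → W) → Prop) [hP : Dfn P] [hQ : Dfn Q] :
    Dfn (fun v => P v ∨ Q v) := ⟨hP.out.union hQ.out⟩

instance Dfn.not (P : (Fin n → W) → Prop) [hP : Dfn P] : Dfn (fun v => ¬ P v) :=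
  ⟨hP.out.compl⟩

instance Dfn.imp (P Q : (Fin n → W) → Prop) [hP : Dfn P] [hQ : Dfn Q] :
    Dfn (fun v => P v → Q v) :=
  (Dfn.or (fun v => ¬ P v) Q).congr fun _ => imp_iff_not_or

instance Dfn.iff (P Q : (Fin n → W) → Prop) [hP : Dfn P] [hQ : Dfn Q] :
    Dfn (fun v => P v ↔ Q v) :=
  (Dfn.and (fun v => P v → Q v) (fun v => Q v → P v)).congr fun _ => iff_iff_implies_and_implies

instance Dfn.const (c : Prop) : Dfn (W := W) (n := n) (fun _ => c) := by
  by_cases hc : c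
  · exact ⟨by simp [hc]⟩
  · exact ⟨by simp [hc]⟩

instance Dfn.ex (P : W → (Fin n → W) → Prop)
    [h : Dfn (fun w : Fin (n + 1) → W => P (w 0) (fun i => w i.succ))] :
    Dfn (fun v => ∃ x, P x v) := by
  refine ⟨?_⟩
  convert h.out.image_comp (Fin.succ : Fin n → Fin (n + 1)) using 1
  ext v
  constructor
  · rintro ⟨x, hx⟩
    exact ⟨Fin.cons x v, by simpa using hx, by ext i; simp⟩
  · rintro ⟨w, hw, rfl⟩
    exact ⟨w 0, hw⟩

instance Dfn.all (P : W → (Fin n → W) → Prop)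
    [h : Dfn (fun w : Fin (n + 1) → W => P (w 0) (fun i => w i.succ))] :
    Dfn (fun v => ∀ x, P x v) :=
  (Dfn.not (fun v => ∃ x, ¬ P x v)).congr fun _ => by simp

/-- Substitution of terms for the variables of a definable class. Its special cases below turn the
definability of a relation, stated for variables, into instances that apply to all terms. -/
theorem Dfn.subst {k : ℕ} {P : (Fin k → W) → Prop} (hP : Dfn P)
    (t : Fin k → (Fin n → W) → W) (ht : ∀ i, Tm (t i)) :
    Dfn (fun v => P (fun i => t i v)) := by
  obtain ⟨φ, hφ⟩ := hP.out
  choose τ hτ using fun i => (ht i).out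
  refine ⟨φ.subst τ, ?_⟩
  ext v
  have : ∀ w, P w ↔ φ.Realize w := fun w => by
    have := Set.ext_iff.1 hφ w
    exact this
  simp only [Set.mem_ofPred_eq, this]
  unfold Formula.Realize
  rw [BoundedFormula.realize_subst]
  simp only [hτ]

theorem Dfn.subst₁ {P : W → Prop} (hP : Dfn (fun v : Fin 1 → W => P (v 0)))
    (t : (Fin n → W) → W) [ht : Tm t] : Dfn (fun v => P (t v)) :=
  Dfn.subst hP ![t] (by simpa using ht)

theorem Dfn.subst₂ {P : W → W → Prop} (hP : Dfn (fun v : Fin 2 → W => P (v 0) (v 1)))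
    (t s : (Fin n → W) → W) [ht : Tm t] [hs : Tm s] : Dfn (fun v => P (t v) (s v)) :=
  Dfn.subst hP ![t, s] (by intro i; fin_cases i <;> assumption)

theorem Dfn.subst₃ {P : W → W → W → Prop} (hP : Dfn (fun v : Fin 3 → W => P (v 0) (v 1) (v 2)))
    (t s r : (Fin n → W) → W) [ht : Tm t] [hs : Tm s] [hr : Tm r] :
    Dfn (fun v => P (t v) (s v) (r v)) :=
  Dfn.subst hP ![t, s, r] (by intro i; fin_cases i <;> assumption)

variable [hW : Fact (IsInnerModel W)]

/-! ### Pairs and ordinals of `W` -/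

theorem mem_of_mem {x y : ZFSet.{u}} (hx : x ∈ W) (hy : y ∈ x) : y ∈ W :=
  hW.out.transitive x hx y hy

theorem exists_pair (x y : W) : ∃ p : W, p.1 = {x.1, y.1} := by
  obtain ⟨p, hp⟩ := hW.out.zfc.pairing x y
  refine ⟨p, ZFSet.ext fun z => ?_⟩
  rw [ZFSet.mem_pair]
  constructor
  · intro hz
    have := (hp ⟨z, mem_of_mem p.2 hz⟩).1 hz
    simpa [Subtype.ext_iff] using this
  · rintro (rfl | rfl)
    · exact (hp x).2 (Or.inl rfl)
    · exact (hp y).2 (Or.inr rfl)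

theorem pair_mem (x y : W) : ZFSet.pair x.1 y.1 ∈ W := by
  obtain ⟨p, hp⟩ := exists_pair x x
  obtain ⟨q, hq⟩ := exists_pair x y
  obtain ⟨r, hr⟩ := exists_pair p q
  have : r.1 = ZFSet.pair x.1 y.1 := by
    rw [hr, hp, hq, ZFSet.pair, ZFSet.pair_eq_singleton]
  exact this ▸ r.2

/-- The Kuratowski pair, as an operation on `W`. -/
def opair (x y : W) : W := ⟨ZFSet.pair x.1 y.1, pair_mem x y⟩

theorem opair_inj {x y x' y' : W} : opair x y = opair x' y' ↔ x = x' ∧ y = y' := by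
  simp [opair, Subtype.ext_iff]

/-- A von Neumann ordinal, as an element of `W`. -/
noncomputable def toW (W : Set ZFSet.{u}) [hW : Fact (IsInnerModel W)] (α : Ordinal.{u}) : W :=
  ⟨α.toZFSet, hW.out.ordinals α⟩

theorem toW_inj {α β : Ordinal.{u}} : toW W α = toW W β ↔ α = β := by
  simp [toW, Ordinal.toZFSet_injective.eq_iff]

open Classical in
/-- The ordinal coded by an element of `W`, with junk value `0`. -/
noncomputable def ord (x : W) : Ordinal.{u} := if x.1.IsOrdinal then x.1.rank else 0

@[simp] theorem ord_toW (α : Ordinal.{u}) : ord (toW W α) = α := by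
  simp [ord, toW, ZFSet.isOrdinal_toZFSet]

theorem toW_ord {x : W} (hx : x.1.IsOrdinal) : toW W (ord x) = x := by
  simp [ord, toW, hx, hx.toZFSet_rank_eq]

theorem eq_toW_of_mem {x : W} {α : Ordinal.{u}} (h : x.1 ∈ (toW W α).1) :
    ∃ β < α, x = toW W β := by
  obtain ⟨β, hβ, h⟩ := Ordinal.mem_toZFSet_iff.1 h
  exact ⟨β, hβ, Subtype.ext h.symm⟩

theorem toW_mem_toW {α β : Ordinal.{u}} : (toW W α).1 ∈ (toW W β).1 ↔ α < β :=
  Ordinal.toZFSet_mem_toZFSet_iff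

/-- `a` is an ordinal-valued term: the ordinal coded by a variable or a constant. -/
class OTm (a : (Fin n → W) → Ordinal.{u}) : Prop where
  out : ∃ t : (Fin n → W) → W, Tm t ∧ ∀ v, a v = ord (t v)

instance OTm.ord (t : (Fin n → W) → W) [ht : Tm t] : OTm (fun v => ord (t v)) :=
  ⟨t, ht, fun _ => rfl⟩

instance OTm.const (α : Ordinal.{u}) : OTm (W := W) (n := n) (fun _ => α) :=
  ⟨fun _ => toW W α, inferInstance, fun _ => (ord_toW α).symm⟩

omit hW in
/-- To prove definability, an ordinal-valued term may be replaced by the ordinal coded by a term. -/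
theorem Dfn.osubst {P : Ordinal.{u} → (Fin n → W) → Prop}
    (a : (Fin n → W) → Ordinal.{u}) [ha : OTm a]
    (h : ∀ t : (Fin n → W) → W, Tm t → Dfn (fun v => P (InnerModel.ord (t v)) v)) :
    Dfn (fun v => P (a v) v) := by
  obtain ⟨t, ht, hat⟩ := ha.out
  simpa only [hat] using h t ht

/-! ### Absoluteness of basic notions -/

theorem isTransitive_iff {x : W} :
    x.1.IsTransitive ↔ ∀ y : W, y.1 ∈ x.1 → ∀ z : W, z.1 ∈ y.1 → z.1 ∈ x.1 := by
  constructor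
  · intro h y hy z hz
    exact h y.1 hy hz
  · intro h y hy z hz
    exact h ⟨y, mem_of_mem x.2 hy⟩ hy ⟨z, mem_of_mem (mem_of_mem x.2 hy) hz⟩ hz

instance Dfn.isTransitive (t : (Fin n → W) → W) [ht : Tm t] :
    Dfn (fun v => (t v).1.IsTransitive) := by
  have : Dfn (fun v : Fin 1 → W => (v 0).1.IsTransitive) := by
    simp only [isTransitive_iff]
    infer_instance
  exact Dfn.subst₁ (P := fun x => x.1.IsTransitive) this t

instance Dfn.isOrdinal (t : (Fin n → W) → W) [ht : Tm t] :
    Dfn (fun v => (t v).1.IsOrdinal) := by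
  have : Dfn (fun v : Fin 1 → W => (v 0).1.IsOrdinal) := by
    have : Dfn (fun v : Fin 1 → W => (v 0).1.IsTransitive ∧
      ∀ y : W, y.1 ∈ (v 0).1 → y.1.IsTransitive) := inferInstance
    refine this.congr fun v => ?_
    rw [ZFSet.isOrdinal_iff_forall_mem_isTransitive]
    exact and_congr_right fun _ =>
      ⟨fun h y hy => h y.1 hy, fun h y hy => h ⟨y, mem_of_mem (v 0).2 hy⟩ hy⟩
  exact Dfn.subst₁ (P := fun x => x.1.IsOrdinal) this t

omit hW in
theorem ord_of_not {x : W} (h : ¬ x.1.IsOrdinal) : ord x = 0 := by simp [ord, h]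

/-- The order of the coded ordinals, in terms of membership. The second disjunct accounts for the
junk value `ord x = 0`. -/
theorem ord_lt_ord_iff {x y : W} : ord x < ord y ↔ y.1.IsOrdinal ∧
    ((x.1.IsOrdinal ∧ x.1 ∈ y.1) ∨ (¬ x.1.IsOrdinal ∧ ∃ z : W, z.1 ∈ y.1)) := by
  by_cases hy : y.1.IsOrdinal
  · by_cases hx : x.1.IsOrdinal
    · have : x.1 ∈ y.1 ↔ ord x < ord y := by
        conv_lhs => rw [← toW_ord hx, ← toW_ord hy, toW_mem_toW]
      simp [hx, hy, this]
    · rw [ord_of_not hx]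
      simp only [hy, hx, false_and, not_false_eq_true, true_and, false_or]
      rw [← toW_ord hy, ord_toW]
      constructor
      · intro h
        exact ⟨toW W 0, toW_mem_toW.2 h⟩
      · rintro ⟨z, hz⟩
        obtain ⟨β, hβ, -⟩ := eq_toW_of_mem hz
        exact pos_of_gt hβ
  · simp [ord_of_not hy, hy]

instance Dfn.olt (a b : (Fin n → W) → Ordinal.{u}) [ha : OTm a] [hb : OTm b] :
    Dfn (fun v => a v < b v) := by
  refine Dfn.osubst (P := fun α v => α < b v) a fun t ht => ?_
  refine Dfn.osubst (P := fun β v => InnerModel.ord (t v) < β) b fun s hs => ?_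
  have h : Dfn (fun v : Fin 2 → W => InnerModel.ord (v 0) < InnerModel.ord (v 1)) := by
    simp only [ord_lt_ord_iff]
    infer_instance
  exact Dfn.subst₂ (P := fun x y => InnerModel.ord x < InnerModel.ord y) h t s

instance Dfn.ole (a b : (Fin n → W) → Ordinal.{u}) [ha : OTm a] [hb : OTm b] :
    Dfn (fun v => a v ≤ b v) :=
  (Dfn.not (fun v => b v < a v)).congr fun _ => not_lt.symm

instance Dfn.oeq (a b : (Fin n → W) → Ordinal.{u}) [ha : OTm a] [hb : OTm b] :
    Dfn (fun v => a v = b v) :=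
  (Dfn.and (fun v => a v ≤ b v) (fun v => b v ≤ a v)).congr fun _ => le_antisymm_iff

instance Dfn.oex (P : Ordinal.{u} → (Fin n → W) → Prop)
    [h : Dfn (fun w : Fin (n + 1) → W => P (InnerModel.ord (w 0)) (fun i => w i.succ))] :
    Dfn (fun v => ∃ α, P α v) :=
  (Dfn.ex (fun x v => P (InnerModel.ord x) v)).congr fun _ =>
    ⟨fun ⟨α, h⟩ => ⟨toW W α, by simpa using h⟩, fun ⟨x, h⟩ => ⟨_, h⟩⟩

instance Dfn.oall (P : Ordinal.{u} → (Fin n → W) → Prop)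
    [h : Dfn (fun w : Fin (n + 1) → W => P (InnerModel.ord (w 0)) (fun i => w i.succ))] :
    Dfn (fun v => ∀ α, P α v) :=
  (Dfn.not (fun v => ∃ α, ¬ P α v)).congr fun _ => by simp

theorem eq_upair_iff {z x y : W} : z.1 = {x.1, y.1} ↔ ∀ w : W, w.1 ∈ z.1 ↔ w = x ∨ w = y := by
  constructor
  · intro h w
    rw [h, ZFSet.mem_pair, Subtype.ext_iff, Subtype.ext_iff]
  · intro h
    ext w
    rw [ZFSet.mem_pair]
    constructor
    · intro hw
      simpa [Subtype.ext_iff] using (h ⟨w, mem_of_mem z.2 hw⟩).1 hw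
    · rintro (rfl | rfl)
      · exact (h x).2 (Or.inl rfl)
      · exact (h y).2 (Or.inr rfl)

/-- The Kuratowski pair in terms of membership between elements of `W`. -/
theorem eq_opair_iff {z x y : W} : z = opair x y ↔ ∃ p q : W, (∀ w : W, w.1 ∈ p.1 ↔ w = x) ∧
    (∀ w : W, w.1 ∈ q.1 ↔ w = x ∨ w = y) ∧ (∀ w : W, w.1 ∈ z.1 ↔ w = p ∨ w = q) := by
  constructor
  · rintro rfl
    obtain ⟨p, hp⟩ := exists_pair x x
    obtain ⟨q, hq⟩ := exists_pair x y
    refine ⟨p, q, ?_, eq_upair_iff.1 hq, eq_upair_iff.1 ?_⟩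
    · simpa using eq_upair_iff.1 hp
    · rw [hp, hq, ZFSet.pair_eq_singleton]
      rfl
  · rintro ⟨p, q, hp, hq, hz⟩
    have hp' : p.1 = {x.1, x.1} := eq_upair_iff.2 (by simpa using hp)
    have hq' := eq_upair_iff.2 hq
    have hz' := eq_upair_iff.2 hz
    rw [hp', hq', ZFSet.pair_eq_singleton] at hz'
    exact Subtype.ext hz'

instance Dfn.opair (z x y : (Fin n → W) → W) [Tm z] [Tm x] [Tm y] :
    Dfn (fun v => z v = InnerModel.opair (x v) (y v)) := by
  have : Dfn (fun v : Fin 3 → W => v 0 = InnerModel.opair (v 1) (v 2)) := by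
    simp only [eq_opair_iff]
    infer_instance
  exact Dfn.subst₃ (P := fun z x y => z = InnerModel.opair x y) this z x y

instance Dfn.toW (z : (Fin n → W) → W) (a : (Fin n → W) → Ordinal.{u}) [Tm z] [OTm a] :
    Dfn (fun v => z v = InnerModel.toW W (a v)) :=
  (Dfn.and (fun v => (z v).1.IsOrdinal) (fun v => InnerModel.ord (z v) = a v)).congr fun v =>
    ⟨fun h => ⟨by rw [h]; exact ZFSet.isOrdinal_toZFSet _, by simp [h]⟩,
      fun h => by rw [← h.2, toW_ord h.1]⟩

/-- `x` contains the pair of `y` and `z`: these are related by the set `x`, viewed as a relation. -/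
def rel (x y z : W) : Prop := (opair y z).1 ∈ x.1

/-- `x` contains the ordinal `α`. -/
def omem (x : W) (α : Ordinal.{u}) : Prop := (toW W α).1 ∈ x.1

/-- `x` contains the pair of ordinals `α` and `β`. -/
def orel (x : W) (α β : Ordinal.{u}) : Prop := rel x (toW W α) (toW W β)

instance Dfn.rel (x y z : (Fin n → W) → W) [Tm x] [Tm y] [Tm z] :
    Dfn (fun v => InnerModel.rel (x v) (y v) (z v)) := by
  have : Dfn (fun v : Fin 3 → W => ∃ p : W, p = InnerModel.opair (v 1) (v 2) ∧ p.1 ∈ (v 0).1) :=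
    inferInstance
  have h : Dfn (fun v : Fin 3 → W => InnerModel.rel (v 0) (v 1) (v 2)) :=
    this.congr fun v => by simp [InnerModel.rel]
  exact Dfn.subst₃ (P := fun z x y => InnerModel.rel z x y) h x y z

instance Dfn.omem (x : (Fin n → W) → W) (a : (Fin n → W) → Ordinal.{u}) [Tm x] [OTm a] :
    Dfn (fun v => InnerModel.omem (x v) (a v)) := by
  refine Dfn.osubst (P := fun α v => InnerModel.omem (x v) α) a fun t ht => ?_
  have h : Dfn (fun v : Fin 2 → W => InnerModel.omem (v 0) (InnerModel.ord (v 1))) := by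
    have : Dfn (fun v : Fin 2 → W =>
      ∃ p : W, p = InnerModel.toW W (InnerModel.ord (v 1)) ∧ p.1 ∈ (v 0).1) := inferInstance
    exact this.congr fun v => by simp [InnerModel.omem]
  exact Dfn.subst₂ (P := fun x y => InnerModel.omem x (InnerModel.ord y)) h x t

instance Dfn.orel (x : (Fin n → W) → W) (a b : (Fin n → W) → Ordinal.{u})
    [Tm x] [OTm a] [OTm b] : Dfn (fun v => InnerModel.orel (x v) (a v) (b v)) := by
  refine Dfn.osubst (P := fun α v => InnerModel.orel (x v) α (b v)) a fun t ht => ?_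
  refine Dfn.osubst (P := fun β v => InnerModel.orel (x v) (InnerModel.ord (t v)) β) b
    fun s hs => ?_
  have h : Dfn (fun v : Fin 3 → W =>
      InnerModel.orel (v 0) (InnerModel.ord (v 1)) (InnerModel.ord (v 2))) := by
    have : Dfn (fun v : Fin 3 → W => ∃ p : W, p = InnerModel.toW W (InnerModel.ord (v 1)) ∧
        ∃ q : W, q = InnerModel.toW W (InnerModel.ord (v 2)) ∧ InnerModel.rel (v 0) p q) :=
      inferInstance
    exact this.congr fun v => by simp [InnerModel.orel]
  exact Dfn.subst₃ (P := fun x y z => InnerModel.orel x (InnerModel.ord y) (InnerModel.ord z))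
    h x t s

omit hW in
theorem Dfn.osubst₁ {P : Ordinal.{u} → Prop}
    (hP : Dfn (fun v : Fin 1 → W => P (InnerModel.ord (v 0))))
    (a : (Fin n → W) → Ordinal.{u}) [OTm a] : Dfn (fun v => P (a v)) :=
  Dfn.osubst (P := fun α _ => P α) a fun t _ =>
    Dfn.subst₁ (P := fun x => P (InnerModel.ord x)) hP t

omit hW in
theorem Dfn.osubst₂ {P : Ordinal.{u} → Ordinal.{u} → Prop}
    (hP : Dfn (fun v : Fin 2 → W => P (InnerModel.ord (v 0)) (InnerModel.ord (v 1))))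
    (a b : (Fin n → W) → Ordinal.{u}) [OTm a] [OTm b] : Dfn (fun v => P (a v) (b v)) :=
  Dfn.osubst (P := fun α v => P α (b v)) a fun t _ =>
    Dfn.osubst (P := fun β v => P (InnerModel.ord (t v)) β) b fun s _ =>
      Dfn.subst₂ (P := fun x y => P (InnerModel.ord x) (InnerModel.ord y)) hP t s

omit hW in
theorem Dfn.osubst₃ {P : Ordinal.{u} → Ordinal.{u} → Ordinal.{u} → Prop}
    (hP : Dfn (fun v : Fin 3 → W =>
      P (InnerModel.ord (v 0)) (InnerModel.ord (v 1)) (InnerModel.ord (v 2))))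
    (a b c : (Fin n → W) → Ordinal.{u}) [OTm a] [OTm b] [OTm c] :
    Dfn (fun v => P (a v) (b v) (c v)) :=
  Dfn.osubst (P := fun α v => P α (b v) (c v)) a fun t _ =>
    Dfn.osubst (P := fun β v => P (InnerModel.ord (t v)) β (c v)) b fun s _ =>
      Dfn.osubst (P := fun γ v => P (InnerModel.ord (t v)) (InnerModel.ord (s v)) γ) c fun r _ =>
        Dfn.subst₃ (P := fun x y z =>
          P (InnerModel.ord x) (InnerModel.ord y) (InnerModel.ord z)) hP t s r

instance Dfn.relToW (x z : (Fin n → W) → W) (a : (Fin n → W) → Ordinal.{u})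
    [Tm x] [OTm a] [Tm z] : Dfn (fun v => InnerModel.rel (x v) (InnerModel.toW W (a v)) (z v)) := by
  refine Dfn.osubst (P := fun α v => InnerModel.rel (x v) (InnerModel.toW W α) (z v)) a
    fun t ht => ?_
  have h : Dfn (fun v : Fin 3 → W =>
      InnerModel.rel (v 0) (InnerModel.toW W (InnerModel.ord (v 1))) (v 2)) := by
    have : Dfn (fun v : Fin 3 → W => ∃ p : W, p = InnerModel.toW W (InnerModel.ord (v 1)) ∧
        InnerModel.rel (v 0) p (v 2)) :=
      inferInstance
    exact this.congr fun v => by simp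
  exact Dfn.subst₃ (P := fun x y z =>
    InnerModel.rel x (InnerModel.toW W (InnerModel.ord y)) z) h x t z

/-! ### Comprehension -/

theorem exists_sep (x : W) (P : W → Prop) (hP : Dfn (fun v : Fin 1 → W => P (v 0))) :
    ∃ y : W, ∀ z : W, z.1 ∈ y.1 ↔ z.1 ∈ x.1 ∧ P z :=
  hW.out.zfc.separation {z | P z} hP.out x

theorem exists_powerset (x : W) :
    ∃ y : W, ∀ z : W, z.1 ∈ y.1 ↔ ∀ t : W, t.1 ∈ z.1 → t.1 ∈ x.1 :=
  hW.out.zfc.powerset x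

theorem exists_prod (x y : W) :
    ∃ z : W, ∀ p : W, p.1 ∈ z.1 ↔ ∃ a b : W, a.1 ∈ x.1 ∧ b.1 ∈ y.1 ∧ p = opair a b := by
  obtain ⟨q, hq⟩ := hW.out.zfc.pairing x y
  obtain ⟨s, hs⟩ := hW.out.zfc.union q
  obtain ⟨t, ht⟩ := exists_powerset s
  obtain ⟨r, hr⟩ := exists_powerset t
  obtain ⟨z, hz⟩ := exists_sep r (fun p => ∃ a b : W, a.1 ∈ x.1 ∧ b.1 ∈ y.1 ∧ p = opair a b)
    inferInstance
  refine ⟨z, fun p => ?_⟩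
  rw [hz]
  refine and_iff_right_of_imp ?_
  rintro ⟨a, b, ha, hb, hp⟩
  have has : a.1 ∈ s.1 := (hs a).2 ⟨x, ha, (hq x).2 (Or.inl rfl)⟩
  have hbs : b.1 ∈ s.1 := (hs b).2 ⟨y, hb, (hq y).2 (Or.inr rfl)⟩
  obtain ⟨c, d, hc, hd, hpe⟩ := eq_opair_iff.1 hp
  rw [hr]
  intro e he
  rw [ht]
  intro f hf
  rcases (hpe e).1 he with rfl | rfl
  · rw [(hc f).1 hf]; exact has
  · rcases (hd f).1 hf with rfl | rfl <;> assumption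

/-- Comprehension for relations between two sets of `W`. -/
theorem exists_rel (x y : W) (P : W → W → Prop) (hP : Dfn (fun v : Fin 2 → W => P (v 0) (v 1))) :
    ∃ z : W, (∀ p : W, p.1 ∈ z.1 → ∃ a b : W, a.1 ∈ x.1 ∧ b.1 ∈ y.1 ∧ p = opair a b) ∧
      ∀ a b : W, rel z a b ↔ a.1 ∈ x.1 ∧ b.1 ∈ y.1 ∧ P a b := by
  obtain ⟨q, hq⟩ := exists_prod x y
  have : ∀ {n : ℕ} (t s : (Fin n → W) → W) [Tm t] [Tm s], Dfn (fun v => P (t v) (s v)) :=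
    fun t s _ _ => hP.subst₂ t s
  obtain ⟨z, hz⟩ := exists_sep q (fun p => ∃ a b : W, p = opair a b ∧ P a b) inferInstance
  refine ⟨z, fun p hp => (hq p).1 ((hz p).1 hp).1, fun a b => ?_⟩
  rw [rel, hz, hq]
  constructor
  · rintro ⟨⟨a', b', ha, hb, h⟩, c, d, h', hP⟩
    obtain ⟨rfl, rfl⟩ := opair_inj.1 h
    obtain ⟨rfl, rfl⟩ := opair_inj.1 h'
    exact ⟨ha, hb, hP⟩
  · rintro ⟨ha, hb, hP⟩
    exact ⟨⟨a, b, ha, hb, rfl⟩, a, b, rfl, hP⟩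

/-- Comprehension for bounded sets of ordinals. -/
theorem exists_oset (θ : Ordinal.{u}) (P : Ordinal.{u} → Prop)
    (hP : Dfn (fun v : Fin 1 → W => P (ord (v 0)))) :
    ∃ y : W, y.1 ⊆ θ.toZFSet ∧ ∀ α, omem y α ↔ α < θ ∧ P α := by
  obtain ⟨y, hy⟩ := exists_sep (toW W θ) (fun x => P (ord x)) hP
  refine ⟨y, fun z hz => ((hy ⟨z, mem_of_mem y.2 hz⟩).1 hz).1, fun α => ?_⟩
  rw [omem, hy, toW_mem_toW, ord_toW]

/-- Comprehension for bounded relations between ordinals. -/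
theorem exists_orel (θ η : Ordinal.{u}) (P : Ordinal.{u} → Ordinal.{u} → Prop)
    (hP : Dfn (fun v : Fin 2 → W => P (ord (v 0)) (ord (v 1)))) :
    ∃ z : W, (∀ p : W, p.1 ∈ z.1 → ∃ α < θ, ∃ β < η, p = opair (toW W α) (toW W β)) ∧
      ∀ α β, orel z α β ↔ α < θ ∧ β < η ∧ P α β := by
  obtain ⟨z, hz, hz'⟩ := exists_rel (toW W θ) (toW W η) (fun x y => P (ord x) (ord y)) hP
  refine ⟨z, fun p hp => ?_, fun α β => ?_⟩
  · obtain ⟨a, b, ha, hb, hp⟩ := hz p hp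
    obtain ⟨α, hα, rfl⟩ := eq_toW_of_mem ha
    obtain ⟨β, hβ, rfl⟩ := eq_toW_of_mem hb
    exact ⟨α, hα, β, hβ, hp⟩
  · rw [orel, hz', toW_mem_toW, toW_mem_toW, ord_toW, ord_toW]

/-! ### Recursion, choice and well-orderings in `W` -/

/-- Recursion along a definable transitive well-founded relation `r` on the set `X`. The function
`a` is given in the universe, and `F g z` says that `z` is the value that the recursion computes
from `g`; by `haF` this is `a x` when `g` is the restriction of `a` to the predecessors of `x`. -/
theorem dfn_recursion (X Y : W) (r : W → W → Prop) (hr : Dfn (fun v : Fin 2 → W => r (v 0) (v 1)))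
    (hwf : WellFounded r) (htr : ∀ x y z, r x y → r y z → r x z)
    (F : W → W → Prop) (hF : Dfn (fun v : Fin 2 → W => F (v 0) (v 1)))
    (a : W → W) (haY : ∀ x : W, x.1 ∈ X.1 → (a x).1 ∈ Y.1)
    (haF : ∀ x : W, x.1 ∈ X.1 → ∀ g : W,
      (∀ y w, rel g y w ↔ y.1 ∈ X.1 ∧ r y x ∧ w = a y) → ∀ z, F g z ↔ z = a x) :
    Dfn (fun v : Fin 2 → W => (v 0).1 ∈ X.1 ∧ v 1 = a (v 0)) := by
  have ir : ∀ {n : ℕ} (t s : (Fin n → W) → W) [Tm t] [Tm s], Dfn (fun v => r (t v) (s v)) :=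
    fun t s _ _ => hr.subst₂ t s
  have iF : ∀ {n : ℕ} (t s : (Fin n → W) → W) [Tm t] [Tm s], Dfn (fun v => F (t v) (s v)) :=
    fun t s _ _ => hF.subst₂ t s
  -- `A x g` says that `g` is an attempt at `x`: a relation on the predecessors of `x` whose values
  -- are computed by `F` from its own restrictions
  let A : W → W → Prop := fun x g => ∀ y w, rel g y w ↔ y.1 ∈ X.1 ∧ r y x ∧
    ∃ g', (∀ y' w', rel g' y' w' ↔ r y' y ∧ rel g y' w') ∧ F g' w
  have iE : Dfn (fun v : Fin 2 → W => ∃ g, (∀ y w, rel g y w ↔ y.1 ∈ X.1 ∧ r y (v 0) ∧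
    ∃ g', (∀ y' w', rel g' y' w' ↔ r y' y ∧ rel g y' w') ∧ F g' w) ∧ F g (v 1)) := inferInstance
  change Dfn (fun v : Fin 2 → W => ∃ g, A (v 0) g ∧ F g (v 1)) at iE
  -- the values of an attempt are those of `a`
  have hA : ∀ x : W, x.1 ∈ X.1 → ∀ g, A x g → ∀ y w, rel g y w ↔ y.1 ∈ X.1 ∧ r y x ∧ w = a y := by
    intro x hx g hg y
    induction y using hwf.induction with
    | _ y ih =>
      intro w
      rw [hg]
      refine and_congr_right fun hy => and_congr_right fun hyx => ?_
      have key : ∀ g', (∀ y' w', rel g' y' w' ↔ r y' y ∧ rel g y' w') → (F g' w ↔ w = a y) := by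
        intro g' hg'
        refine haF y hy g' (fun y' w' => ?_) w
        rw [hg']
        constructor
        · rintro ⟨h1, h2⟩
          have := (ih y' h1 w').1 h2
          exact ⟨this.1, h1, this.2.2⟩
        · rintro ⟨h1, h2, h3⟩
          exact ⟨h2, (ih y' h2 w').2 ⟨h1, htr _ _ _ h2 hyx, h3⟩⟩
      constructor
      · rintro ⟨g', hg', hFg⟩
        exact (key g' hg').1 hFg
      · intro hw
        obtain ⟨g', -, hg'⟩ := exists_rel X Y (fun y' w' => r y' y ∧ rel g y' w') inferInstance
        have : ∀ y' w', rel g' y' w' ↔ r y' y ∧ rel g y' w' := by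
          intro y' w'
          rw [hg']
          refine ⟨fun h => h.2.2, fun h => ?_⟩
          obtain ⟨h1, -, h3⟩ := (ih y' h.1 w').1 h.2
          exact ⟨h1, h3 ▸ haY y' h1, h⟩
        exact ⟨g', this, (key g' this).2 hw⟩
  -- the attempt at `x` exists in `W`: comprehension applies, as by the induction hypothesis `a` is
  -- definable on the predecessors of `x`
  have hE : ∀ x : W, x.1 ∈ X.1 → ∀ z, (∃ g, A x g ∧ F g z) ↔ z = a x := by
    intro x
    induction x using hwf.induction with
    | _ x ih =>
      intro hx z
      constructor
      · rintro ⟨g, hg, hFg⟩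
        exact (haF x hx g (hA x hx g hg) z).1 hFg
      · intro hz
        have iE' : ∀ {n : ℕ} (t s : (Fin n → W) → W) [Tm t] [Tm s],
            Dfn (fun v => ∃ g, A (t v) g ∧ F g (s v)) :=
          fun t s _ _ => Dfn.subst₂ (P := fun x y => ∃ g, A x g ∧ F g y) iE t s
        obtain ⟨g, -, hg⟩ := exists_rel X Y (fun y w => r y x ∧ ∃ g, A y g ∧ F g w)
          (Dfn.and _ _ (hQ := iE' (fun v => v 0) (fun v => v 1)))
        have hg' : ∀ y w, rel g y w ↔ y.1 ∈ X.1 ∧ r y x ∧ w = a y := by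
          intro y w
          rw [hg]
          constructor
          · rintro ⟨h1, h2, h3, h4⟩
            exact ⟨h1, h3, (ih y h3 h1 w).1 h4⟩
          · rintro ⟨h1, h2, h3⟩
            exact ⟨h1, h3 ▸ haY y h1, h2, (ih y h2 h1 w).2 h3⟩
        refine ⟨g, fun y w => ?_, (haF x hx g hg' z).2 hz⟩
        rw [hg']
        refine and_congr_right fun hy => and_congr_right fun hyx => ?_
        have key : ∀ g', (∀ y' w', rel g' y' w' ↔ r y' y ∧ rel g y' w') →
            (F g' w ↔ w = a y) := by
          intro g' hg''
          refine haF y hy g' (fun y' w' => ?_) w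
          rw [hg'', hg']
          exact ⟨fun h => ⟨h.2.1, h.1, h.2.2.2⟩,
            fun h => ⟨h.2.1, h.1, htr _ _ _ h.2.1 hyx, h.2.2⟩⟩
        constructor
        · intro hw
          obtain ⟨g', -, h'⟩ := exists_rel X Y (fun y' w' => r y' y ∧ rel g y' w') inferInstance
          have : ∀ y' w', rel g' y' w' ↔ r y' y ∧ rel g y' w' := by
            intro y' w'
            rw [h']
            refine ⟨fun h => h.2.2, fun h => ?_⟩
            obtain ⟨h1, -, h3⟩ := (hg' y' w').1 h.2
            exact ⟨h1, h3 ▸ haY y' h1, h⟩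
          exact ⟨g', this, (key g' this).2 hw⟩
        · rintro ⟨g', h1, h2⟩
          exact (key g' h1).1 h2
  have : Dfn (fun v : Fin 2 → W => (v 0).1 ∈ X.1 ∧ ∃ g, A (v 0) g ∧ F g (v 1)) :=
    Dfn.and _ _ (hQ := iE)
  exact this.congr fun v => and_congr_right fun hv => (hE _ hv _).symm

/-- The axiom of choice, for definable relations between two sets of `W`. -/
theorem exists_choice (I J : W) (Q : W → W → Prop) (hQ : Dfn (fun v : Fin 2 → W => Q (v 0) (v 1))) :
    ∃ c : W, ∀ i : W, i.1 ∈ I.1 → (∃ j : W, j.1 ∈ J.1 ∧ Q i j) →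
      ∃ j : W, j.1 ∈ J.1 ∧ Q i j ∧ ∀ j', rel c i j' ↔ j' = j := by
  obtain ⟨q, hq0, hq⟩ := exists_rel I J Q hQ
  obtain ⟨t, ht⟩ := exists_powerset q
  obtain ⟨x, hx⟩ := exists_sep t (fun s => (∃ p : W, p.1 ∈ s.1) ∧
    ∃ i : W, ∀ p : W, p.1 ∈ s.1 ↔ p.1 ∈ q.1 ∧ ∃ j, p = opair i j) inferInstance
  -- `x` consists of the nonempty sections of `q`, tagged with their indices, hence disjoint
  obtain ⟨c, hc⟩ := hW.out.zfc.choice x (fun y hy => ((hx y).1 hy).2.1) (by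
    intro y y' hy hy' hne z hz
    obtain ⟨-, -, i, hi⟩ := (hx y).1 hy
    obtain ⟨-, -, i', hi'⟩ := (hx y').1 hy'
    obtain ⟨-, j, hj⟩ := (hi z).1 hz.1
    obtain ⟨-, j', hj'⟩ := (hi' z).1 hz.2
    obtain ⟨rfl, rfl⟩ := opair_inj.1 (hj.symm.trans hj')
    exact hne (hW.out.zfc.extensionality _ _ fun p => (hi p).trans (hi' p).symm))
  obtain ⟨d, -, hd⟩ := exists_rel I J (fun i j => rel q i j ∧ rel c i j) inferInstance
  refine ⟨d, fun i hi ⟨j, hj, hij⟩ => ?_⟩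
  obtain ⟨s, hs⟩ := exists_sep q (fun p => ∃ j, p = opair i j) inferInstance
  have hsx : s.1 ∈ x.1 := by
    refine (hx s).2 ⟨(ht s).2 fun p hp => ((hs p).1 hp).1, ⟨opair i j, ?_⟩, i, hs⟩
    exact (hs _).2 ⟨(hq i j).2 ⟨hi, hj, hij⟩, j, rfl⟩
  obtain ⟨z, ⟨hzs, hzc⟩, hz⟩ := hc s hsx
  obtain ⟨hzq, k, rfl⟩ := (hs z).1 hzs
  have hk := (hq i k).1 hzq
  refine ⟨k, hk.2.1, hk.2.2, fun j' => ?_⟩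
  rw [hd]
  constructor
  · rintro ⟨-, -, h1, h2⟩
    exact (opair_inj.1 (hz (opair i j') ⟨(hs _).2 ⟨h1, j', rfl⟩, h2⟩)).2
  · rintro rfl
    exact ⟨hi, hk.2.1, hzq, hzc⟩

omit hW in
theorem small_mem (X : W) : Small.{u} {x : W // x.1 ∈ X.1} :=
  small_of_injective (β := X.1) (f := fun x => ⟨x.1.1, x.2⟩)
    fun x y h => Subtype.ext (Subtype.ext (by simpa using h))

/-- The well-ordering theorem in `W`: every set of `W` is the range of a function of `W` whose
domain consists of ordinals. -/
theorem exists_enum (B : W) : ∃ (g : W) (θ : Ordinal.{u}),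
    (∀ α y y', rel g (toW W α) y → rel g (toW W α) y' → y = y') ∧
      ∀ y : W, y.1 ∈ B.1 → ∃ α < θ, rel g (toW W α) y := by
  classical
  by_cases hB : ∃ b : W, b.1 ∈ B.1
  swap
  · refine ⟨toW W 0, 0, fun α y y' h => ?_, fun y hy => (hB ⟨y, hy⟩).elim⟩
    obtain ⟨β, hβ, -⟩ := eq_toW_of_mem h
    exact absurd hβ not_lt_zero
  obtain ⟨b, hb⟩ := hB
  obtain ⟨I, hI⟩ := exists_powerset B
  obtain ⟨c, hc⟩ := exists_choice I B (fun i j => j.1 ∈ i.1) inferInstance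
  -- the value computed from `g` is the chosen element of `B` outside the range of `g`, and `b` when
  -- the range exhausts `B`
  let F : W → W → Prop := fun g z => ∃ i : W,
    (∀ w : W, w.1 ∈ i.1 ↔ w.1 ∈ B.1 ∧ ¬ ∃ y, rel g y w) ∧
      (((∃ w : W, w.1 ∈ i.1) ∧ rel c i z) ∨ ((¬ ∃ w : W, w.1 ∈ i.1) ∧ z = b))
  have iF : Dfn (fun v : Fin 2 → W => F (v 0) (v 1)) := by
    simp only [F]
    infer_instance
  -- the same choice, as a function in the universe
  let val : Set W → W := fun s =>
    if h : ∃ j i : W, (∀ w : W, w.1 ∈ i.1 ↔ w.1 ∈ B.1 ∧ w ∉ s) ∧ (∃ w : W, w.1 ∈ i.1) ∧ rel c i j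
      then h.choose else b
  have hval : ∀ (s : Set W) (i : W), (∀ w : W, w.1 ∈ i.1 ↔ w.1 ∈ B.1 ∧ w ∉ s) →
      (∃ w : W, w.1 ∈ i.1) → rel c i (val s) ∧ (val s).1 ∈ i.1 := by
    intro s i hi hw
    have hii : i.1 ∈ I.1 := (hI i).2 fun t ht => ((hi t).1 ht).1
    obtain ⟨w, hw⟩ := hw
    obtain ⟨j, hj, hji, hjc⟩ := hc i hii ⟨w, ((hi w).1 hw).1, hw⟩
    have h : ∃ j i : W, (∀ w : W, w.1 ∈ i.1 ↔ w.1 ∈ B.1 ∧ w ∉ s) ∧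
      (∃ w : W, w.1 ∈ i.1) ∧ rel c i j := ⟨j, i, hi, ⟨w, hw⟩, (hjc j).2 rfl⟩
    obtain ⟨i', hi', -, h'⟩ := h.choose_spec
    have : i' = i := hW.out.zfc.extensionality _ _ fun p => (hi' p).trans (hi p).symm
    subst this
    have : val s = j := by
      simp only [val, dif_pos h]
      exact (hjc _).1 h'
    rw [this]
    exact ⟨(hjc j).2 rfl, hji⟩
  have hval' : ∀ (s : Set W) (i : W), (∀ w : W, w.1 ∈ i.1 ↔ w.1 ∈ B.1 ∧ w ∉ s) →
      (¬ ∃ w : W, w.1 ∈ i.1) → val s = b := by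
    intro s i hi hw
    refine dif_neg ?_
    rintro ⟨j, i', hi', h, -⟩
    obtain ⟨w, hw'⟩ := h
    exact hw ⟨w, (hi w).2 ((hi' w).1 hw')⟩
  have hvalB : ∀ s, (val s).1 ∈ B.1 := by
    intro s
    by_cases h : ∃ j i : W, (∀ w : W, w.1 ∈ i.1 ↔ w.1 ∈ B.1 ∧ w ∉ s) ∧
      (∃ w : W, w.1 ∈ i.1) ∧ rel c i j
    · obtain ⟨j, i, hi, hw, -⟩ := h
      exact ((hi _).1 (hval s i hi hw).2).1
    · have : val s = b := dif_neg h
      rw [this]; exact hb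
  let a : Ordinal.{u} → W := WellFounded.fix (wellFounded_lt (α := Ordinal.{u}))
    fun α f => val {w | ∃ β, ∃ h : β < α, w = f β h}
  have ha : ∀ α, a α = val {w | ∃ β < α, w = a β} := by
    intro α
    simp only [a]
    rw [WellFounded.fix_eq]
    congr 1
    ext w
    simp
  have haB : ∀ α, (a α).1 ∈ B.1 := fun α => by rw [ha]; exact hvalB _
  have hg : ∀ θ : Ordinal.{u}, ∃ g : W, ∀ y w, rel g y w ↔ ∃ β < θ, y = toW W β ∧ w = a β := by
    intro θ
    have := dfn_recursion (toW W θ) B (fun x y => ord x < ord y) inferInstance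
      (InvImage.wf ord wellFounded_lt) (fun x y z h1 h2 => lt_trans h1 h2) F iF
      (fun x => a (ord x)) (fun x _ => haB _) (by
        intro x hx g hg z
        obtain ⟨α, hα, rfl⟩ := eq_toW_of_mem hx
        have hr : ∀ w : W, (¬ ∃ y, rel g y w) ↔ w ∉ {w | ∃ β < α, w = a β} := by
          intro w
          simp only [hg, ord_toW, mem_ofPred_eq, not_iff_not]
          constructor
          · rintro ⟨y, h1, h2, h3⟩
            exact ⟨_, h2, h3⟩
          · rintro ⟨β, hβ, h⟩
            exact ⟨toW W β, toW_mem_toW.2 (hβ.trans hα), by simpa using hβ, by simpa using h⟩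
        obtain ⟨i, hi⟩ := exists_sep B (fun w => ¬ ∃ y, rel g y w) inferInstance
        have hi' : ∀ w : W, w.1 ∈ i.1 ↔ w.1 ∈ B.1 ∧ w ∉ {w | ∃ β < α, w = a β} :=
          fun w => by rw [hi, hr]
        rw [ord_toW, ha]
        constructor
        · rintro ⟨i', hi1, h⟩
          have : i' = i := hW.out.zfc.extensionality _ _ fun p => (hi1 p).trans (hi p).symm
          subst this
          rcases h with ⟨h1, h2⟩ | ⟨h1, rfl⟩
          · have hii : i'.1 ∈ I.1 := (hI i').2 fun t ht => ((hi t).1 ht).1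
            obtain ⟨w, hw⟩ := h1
            obtain ⟨j, hj, hji, hjc⟩ := hc i' hii ⟨w, ((hi w).1 hw).1, hw⟩
            rw [(hjc _).1 h2, (hjc _).1 (hval _ i' hi' ⟨w, hw⟩).1]
          · exact (hval' _ i' hi' h1).symm
        · rintro rfl
          refine ⟨i, hi, ?_⟩
          by_cases h : ∃ w : W, w.1 ∈ i.1
          · exact Or.inl ⟨h, (hval _ i hi' h).1⟩
          · exact Or.inr ⟨h, hval' _ i hi' h⟩)
    obtain ⟨g, -, hg⟩ := exists_rel (toW W θ) B (fun x y => x.1 ∈ (toW W θ).1 ∧ y = a (ord x)) this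
    refine ⟨g, fun y w => ?_⟩
    rw [hg]
    constructor
    · rintro ⟨h1, -, -, h2⟩
      obtain ⟨α, hα, rfl⟩ := eq_toW_of_mem h1
      exact ⟨α, hα, rfl, by simpa using h2⟩
    · rintro ⟨β, hβ, rfl, rfl⟩
      exact ⟨toW_mem_toW.2 hβ, haB _, toW_mem_toW.2 hβ, by simp⟩
  -- `B` is exhausted at some stage, as the ordinals do not inject into a set
  have hex : ∃ θ : Ordinal.{u}, ∀ w : W, w.1 ∈ B.1 → ∃ β < θ, w = a β := by
    by_contra! hcon
    have hinj : Function.Injective a := by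
      have : ∀ α β, β < α → a α ≠ a β := by
        intro α β hβ heq
        obtain ⟨g, hg⟩ := hg α
        obtain ⟨i, hi⟩ := exists_sep B (fun w => ¬ ∃ y, rel g y w) inferInstance
        have hi' : ∀ w : W, w.1 ∈ i.1 ↔ w.1 ∈ B.1 ∧ w ∉ {w | ∃ β < α, w = a β} := by
          intro w
          rw [hi]
          refine and_congr_right fun _ => not_congr ?_
          simp only [hg, mem_ofPred_eq]
          exact ⟨fun ⟨y, β, h, _, h'⟩ => ⟨β, h, h'⟩, fun ⟨β, h, h'⟩ => ⟨_, β, h, rfl, h'⟩⟩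
        obtain ⟨w, hwB, hw⟩ := hcon α
        have := (hval _ i hi' ⟨w, (hi' w).2 ⟨hwB, fun ⟨β, hβ, h⟩ => hw β hβ h⟩⟩).2
        rw [← ha] at this
        exact ((hi' _).1 this).2 ⟨β, hβ, heq⟩
      intro α β h
      by_contra hne
      rcases lt_or_gt_of_ne hne with h' | h'
      · exact this _ _ h' h.symm
      · exact this _ _ h' h
    have := small_mem B
    exact not_injective_of_ordinal (α := {x : W // x.1 ∈ B.1})
      (fun α => ⟨a α, haB α⟩) fun α β h => hinj (by simpa using h)
  obtain ⟨θ, hθ⟩ := hex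
  obtain ⟨g, hg⟩ := hg θ
  refine ⟨g, θ, fun α y y' h h' => ?_, fun y hy => ?_⟩
  · obtain ⟨β, -, h1, rfl⟩ := (hg _ _).1 h
    obtain ⟨β', -, h2, rfl⟩ := (hg _ _).1 h'
    rw [← toW_inj.1 h1, ← toW_inj.1 h2]
  · obtain ⟨β, hβ, rfl⟩ := hθ y hy
    exact ⟨β, hβ, (hg _ _).2 ⟨β, hβ, rfl, rfl⟩⟩

/-- Definable relations with values in a set of `W` can be uniformized definably. -/
theorem exists_uniformization (B : W) (Q : W → W → Prop)
    (hQ : Dfn (fun v : Fin 2 → W => Q (v 0) (v 1))) :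
    ∃ Q' : W → W → Prop, Dfn (fun v : Fin 2 → W => Q' (v 0) (v 1)) ∧ (∀ x y, Q' x y → Q x y) ∧
      (∀ x y y', Q' x y → Q' x y' → y = y') ∧
      ∀ x, (∃ y : W, y.1 ∈ B.1 ∧ Q x y) → ∃ y, Q' x y := by
  obtain ⟨g, _, hg, hgB⟩ := exists_enum B
  have iQ : ∀ {n : ℕ} (t s : (Fin n → W) → W) [Tm t] [Tm s], Dfn (fun v => Q (t v) (s v)) :=
    fun t s _ _ => hQ.subst₂ t s
  refine ⟨fun x y => Q x y ∧ ∃ α : Ordinal.{u}, rel g (toW W α) y ∧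
    ∀ β < α, ¬ ∃ y', rel g (toW W β) y' ∧ Q x y', inferInstance, fun x y h => h.1, ?_, ?_⟩
  · rintro x y y' ⟨h1, α, h2, h3⟩ ⟨h1', α', h2', h3'⟩
    rcases lt_trichotomy α α' with h | rfl | h
    · exact (h3' α h ⟨y, h2, h1⟩).elim
    · exact hg _ _ _ h2 h2'
    · exact (h3 α' h ⟨y', h2', h1'⟩).elim
  · rintro x ⟨y, hy, hxy⟩
    obtain ⟨α, -, hα⟩ := hgB y hy
    have hne : {α | ∃ y, rel g (toW W α) y ∧ Q x y}.Nonempty := ⟨α, y, hα, hxy⟩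
    obtain ⟨z, hz, hxz⟩ := csInf_mem hne
    exact ⟨z, hxz, _, hz, fun β hβ h => notMem_of_lt_csInf' hβ h⟩

/-! ### Ranks and coverings -/

/-- The rank function of a definable transitive well-founded relation on a set of `W` is
definable. Its values below any point form an initial segment. -/
theorem exists_rank (X : W) (r : W → W → Prop) (hr : Dfn (fun v : Fin 2 → W => r (v 0) (v 1)))
    (hrX : ∀ x y, r x y → x.1 ∈ X.1)
    (hwf : WellFounded r) (htr : ∀ x y z, r x y → r y z → r x z) :
    ∃ ρ : W → Ordinal.{u},
      Dfn (fun v : Fin 2 → W => (v 0).1 ∈ X.1 ∧ ord (v 1) = ρ (v 0)) ∧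
      (∀ x y, r x y → ρ x < ρ y) ∧ ∀ y, ∀ γ < ρ y, ∃ x, r x y ∧ ρ x = γ := by
  let ρ : W → Ordinal.{u} := hwf.fix fun x f => sInf {γ | ∀ y, ∀ h : r y x, f y h < γ}
  have hρ : ∀ x, ρ x = sInf {γ | ∀ y, r y x → ρ y < γ} := fun x => by
    simp only [ρ]
    rw [WellFounded.fix_eq]
  have := small_mem X
  have hne : ∀ x, {γ | ∀ y, r y x → ρ y < γ}.Nonempty := fun x =>
    ⟨⨆ y : {y : W // y.1 ∈ X.1}, (ρ y.1 + 1), fun y hy =>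
      Ordinal.lt_iSup_add_one (fun y : {y : W // y.1 ∈ X.1} => ρ y.1) ⟨y, hrX y x hy⟩⟩
  have h1 : ∀ x y, r x y → ρ x < ρ y := by
    intro x y h
    have := csInf_mem (hne y)
    rw [← hρ] at this
    exact this x h
  have h2 : ∀ y, ∀ γ < ρ y, ∃ x, r x y ∧ γ ≤ ρ x := by
    intro y γ hγ
    rw [hρ] at hγ
    have := notMem_of_lt_csInf' hγ
    simpa using this
  have h3 : ∀ y, ∀ γ < ρ y, ∃ x, r x y ∧ ρ x = γ := by
    intro y
    induction y using hwf.induction with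
    | _ y ih =>
      intro γ hγ
      obtain ⟨x, hx, hγx⟩ := h2 y γ hγ
      rcases hγx.eq_or_lt with h | h
      · exact ⟨x, hx, h.symm⟩
      · obtain ⟨z, hz, h'⟩ := ih x hx γ h
        exact ⟨z, htr _ _ _ hz hx, h'⟩
  refine ⟨ρ, ?_, h1, h3⟩
  have hθ : ∃ θ : Ordinal.{u}, ∀ x : W, x.1 ∈ X.1 → ρ x < θ :=
    ⟨⨆ y : {y : W // y.1 ∈ X.1}, (ρ y.1 + 1), fun y hy =>
      Ordinal.lt_iSup_add_one (fun y : {y : W // y.1 ∈ X.1} => ρ y.1) ⟨y, hy⟩⟩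
  obtain ⟨θ, hθ⟩ := hθ
  have hd := dfn_recursion X (toW W θ) r hr hwf htr
    (fun g z => z.1.IsOrdinal ∧ (∀ y w, rel g y w → ord w < ord z) ∧
      ∀ γ < ord z, ∃ y w, rel g y w ∧ γ ≤ ord w) inferInstance
    (fun x => toW W (ρ x)) (fun x hx => toW_mem_toW.2 (hθ x hx)) (by
      intro x hx g hg z
      constructor
      · rintro ⟨hz, h4, h5⟩
        rw [← toW_ord hz]
        congr 1
        refine le_antisymm (le_of_not_gt fun h => ?_) (le_of_not_gt fun h => ?_)
        · obtain ⟨y, w, hyw, hle⟩ := h5 _ h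
          obtain ⟨-, hyx, rfl⟩ := (hg _ _).1 hyw
          rw [ord_toW] at hle
          exact hle.not_gt (h1 _ _ hyx)
        · obtain ⟨y, hy, hyz⟩ := h2 x _ h
          have := h4 y (toW W (ρ y)) ((hg _ _).2 ⟨hrX _ _ hy, hy, rfl⟩)
          rw [ord_toW] at this
          exact hyz.not_gt this
      · rintro rfl
        refine ⟨ZFSet.isOrdinal_toZFSet _, fun y w h => ?_, fun γ hγ => ?_⟩
        · obtain ⟨-, hyx, rfl⟩ := (hg _ _).1 h
          simpa using h1 _ _ hyx
        · rw [ord_toW] at hγ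
          obtain ⟨y, hy, hyz⟩ := h2 x _ hγ
          exact ⟨y, _, (hg _ _).2 ⟨hrX _ _ hy, hy, rfl⟩, by simpa using hyz⟩)
  have hd' : ∀ {n : ℕ} (t s : (Fin n → W) → W) [Tm t] [Tm s],
      Dfn (fun v => (t v).1 ∈ X.1 ∧ s v = toW W (ρ (t v))) :=
    fun t s _ _ => Dfn.subst₂ (P := fun x y => x.1 ∈ X.1 ∧ y = toW W (ρ x)) hd t s
  have : Dfn (fun v : Fin 2 → W => ∃ w, ((v 0).1 ∈ X.1 ∧ w = toW W (ρ (v 0))) ∧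
    ord w = ord (v 1)) :=
    Dfn.ex (fun w v => ((v 0).1 ∈ X.1 ∧ w = toW W (ρ (v 0))) ∧ ord w = ord (v 1))
      (h := Dfn.and _ _ (hP := hd' (fun w => w 1) (fun w => w 0)))
  refine this.congr fun v => ?_
  constructor
  · rintro ⟨hx, h⟩
    exact ⟨_, ⟨hx, rfl⟩, by simp [h]⟩
  · rintro ⟨w, ⟨hx, rfl⟩, h⟩
    exact ⟨hx, by simpa using h.symm⟩

/-- The class `P` of ordinals is included in the image of `ν` under a partial function that is
definable over `W`. For bounded `P` this says that `P` has size at most `ν` in `W`. The graph `E`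
may relate further ordinals, in and outside `ν`. -/
def Covered (W : Set ZFSet.{u}) (ν : Ordinal.{u}) (P : Ordinal.{u} → Prop) : Prop :=
  ∃ E : Ordinal.{u} → Ordinal.{u} → Prop,
    Dfn (W := W) (fun v : Fin 2 → W => E (ord (v 0)) (ord (v 1))) ∧
    (∀ a b b', E a b → E a b' → b = b') ∧ ∀ b, P b → ∃ a < ν, E a b

/-- The set `y` of `W` codes a partial function on ordinals that maps part of `ν` onto a class
that includes `P`: the first-order rendering of `Covered`. -/
def Covers (y : W) (ν : Ordinal.{u}) (P : Ordinal.{u} → Prop) : Prop :=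
  (∀ a b b', orel y a b → orel y a b' → b = b') ∧ ∀ b, P b → ∃ a < ν, orel y a b

theorem Covered.exists_covers {ν : Ordinal.{u}} {P : Ordinal.{u} → Prop} (h : Covered W ν P)
    (θ : Ordinal.{u}) (hθ : ∀ b, P b → b < θ) :
    ∃ y : W, (∀ p : W, p.1 ∈ y.1 → ∃ α < ν, ∃ β < θ, p = opair (toW W α) (toW W β)) ∧
      Covers y ν P := by
  obtain ⟨E, hE, hf, hs⟩ := h
  obtain ⟨y, hy, hy'⟩ := exists_orel ν θ E hE
  refine ⟨y, hy, fun a b b' h h' => ?_, fun b hb => ?_⟩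
  · exact hf a b b' ((hy' _ _).1 h).2.2 ((hy' _ _).1 h').2.2
  · obtain ⟨a, ha, hab⟩ := hs b hb
    exact ⟨a, ha, (hy' _ _).2 ⟨ha, hθ b hb, hab⟩⟩

omit hW in
theorem Covered.mono {ν : Ordinal.{u}} {P Q : Ordinal.{u} → Prop} (h : Covered W ν P)
    (hQ : ∀ b, Q b → P b) : Covered W ν Q := by
  obtain ⟨E, hE, hf, hs⟩ := h
  exact ⟨E, hE, hf, fun b hb => hs b (hQ b hb)⟩

theorem Covered.trans {ν μ : Ordinal.{u}} {P : Ordinal.{u} → Prop} (h : Covered W ν (· < μ))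
    (h' : Covered W μ P) : Covered W ν P := by
  obtain ⟨E, hE, hf, hs⟩ := h
  obtain ⟨E', hE', hf', hs'⟩ := h'
  have iE : ∀ {n : ℕ} (t s : (Fin n → W) → Ordinal.{u}) [OTm t] [OTm s],
    Dfn (fun v => E (t v) (s v)) := fun t s _ _ => hE.osubst₂ t s
  have iE' : ∀ {n : ℕ} (t s : (Fin n → W) → Ordinal.{u}) [OTm t] [OTm s],
    Dfn (fun v => E' (t v) (s v)) := fun t s _ _ => hE'.osubst₂ t s
  refine ⟨fun a c => ∃ b, E a b ∧ E' b c, inferInstance, ?_, ?_⟩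
  · rintro a c c' ⟨b, h1, h2⟩ ⟨b', h3, h4⟩
    obtain rfl := hf _ _ _ h1 h3
    exact hf' _ _ _ h2 h4
  · intro c hc
    obtain ⟨b, hb, hbc⟩ := hs' c hc
    obtain ⟨a, ha, hab⟩ := hs b hb
    exact ⟨a, ha, b, hab, hbc⟩

theorem covered_self (ν : Ordinal.{u}) : Covered W ν (· < ν) :=
  ⟨fun a b => a = b, inferInstance, fun _ _ _ h h' => h.symm.trans h', fun b hb => ⟨b, hb, rfl⟩⟩

open Cardinal in
omit hW in
theorem Covered.card_le {ν : Ordinal.{u}} {P : Ordinal.{u} → Prop} (h : Covered W ν P) :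
    #{b | P b} ≤ Cardinal.lift.{u + 1} ν.card := by
  obtain ⟨E, -, hf, hs⟩ := h
  choose g hg hE using fun b : {b | P b} => hs b.1 b.2
  rw [← Cardinal.mk_Iio_ordinal]
  refine Cardinal.mk_le_of_injective (f := fun b => (⟨g b, hg b⟩ : Iio ν)) fun b b' h => ?_
  have h1 := hE b
  rw [show g b = g b' from Subtype.ext_iff.1 h] at h1
  exact Subtype.ext (hf _ _ _ h1 (hE b'))

open Cardinal in
omit hW in
theorem Covered.card_le_card {ν μ : Ordinal.{u}} (h : Covered W ν (· < μ)) : μ.card ≤ ν.card := by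
  have := h.card_le
  rw [← Cardinal.lift_le.{u + 1}, ← Cardinal.mk_Iio_ordinal]
  exact this

open Ordinal in
/-- Hilbert's hotel: `0` is mapped to `ν`, the positive natural numbers are shifted down by one, and
all other ordinals are fixed. -/
theorem covered_add_one {ν : Ordinal.{u}} (h : ω ≤ ν) : Covered W ν (· < ν + 1) := by
  refine ⟨fun a b => (a = 0 ∧ b = ν) ∨ (0 < a ∧ a < ω ∧ b < a ∧ ∀ c, c < a → c ≤ b) ∨
    (ω ≤ a ∧ a = b), inferInstance, ?_, ?_⟩
  · rintro a b b' (⟨rfl, rfl⟩ | ⟨h1, h2, h3, h4⟩ | ⟨h1, rfl⟩)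
      (⟨h5, rfl⟩ | ⟨h5, h6, h7, h8⟩ | ⟨h5, rfl⟩)
    · rfl
    · exact (lt_irrefl _ h5).elim
    · exact (omega0_pos.not_ge h5).elim
    · exact (h1.ne' h5).elim
    · exact le_antisymm (h8 _ h3) (h4 _ h7)
    · exact (h2.not_ge h5).elim
    · exact (omega0_pos.not_ge (h5 ▸ h1)).elim
    · exact (h6.not_ge h1).elim
    · rfl
  · intro b hb
    rcases lt_or_ge b ω with hbω | hbω
    · exact ⟨b + 1, ((isSuccLimit_omega0.add_one_lt hbω)).trans_le h, Or.inr (Or.inl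
        ⟨by simp, isSuccLimit_omega0.add_one_lt hbω, by simp,
          fun c hc => Order.lt_add_one_iff.1 hc⟩)⟩
    · rcases (Order.lt_add_one_iff.1 hb).eq_or_lt with rfl | hb'
      · exact ⟨0, omega0_pos.trans_le h, Or.inl ⟨rfl, rfl⟩⟩
      · exact ⟨b, hb', Or.inr (Or.inr ⟨hbω, rfl⟩)⟩

/-! ### Gödel pairing -/

/-- Under the definable relation `H`, where `H a b c` says that `a` codes the pair of `b` and `c`,
each pair of ordinals below `δ` has a code below `δ`, and no ordinal codes two pairs. -/
def IsPairing (W : Set ZFSet.{u}) (δ : Ordinal.{u})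
    (H : Ordinal.{u} → Ordinal.{u} → Ordinal.{u} → Prop) : Prop :=
  Dfn (W := W) (fun v : Fin 3 → W => H (ord (v 0)) (ord (v 1)) (ord (v 2))) ∧
    (∀ a b c b' c', H a b c → H a b' c' → b = b' ∧ c = c') ∧
    ∀ b < δ, ∀ c < δ, ∃ a < δ, H a b c

theorem IsPairing.of_covered {ν δ : Ordinal.{u}}
    {H : Ordinal.{u} → Ordinal.{u} → Ordinal.{u} → Prop} (hH : IsPairing W ν H)
    (h : Covered W ν (· < δ)) (hνδ : ν ≤ δ) : ∃ H', IsPairing W δ H' := by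
  obtain ⟨E, hE, hf, hs⟩ := h
  have iE : ∀ {n : ℕ} (t s : (Fin n → W) → Ordinal.{u}) [OTm t] [OTm s],
    Dfn (fun v => E (t v) (s v)) := fun t s _ _ => hE.osubst₂ t s
  have iH : ∀ {n : ℕ} (t s r : (Fin n → W) → Ordinal.{u}) [OTm t] [OTm s] [OTm r],
    Dfn (fun v => H (t v) (s v) (r v)) := fun t s r _ _ _ => hH.1.osubst₃ t s r
  refine ⟨fun a b c => ∃ b' c', H a b' c' ∧ E b' b ∧ E c' c, inferInstance, ?_, ?_⟩
  · rintro a b c b' c' ⟨d, e, h1, h2, h3⟩ ⟨d', e', h4, h5, h6⟩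
    obtain ⟨rfl, rfl⟩ := hH.2.1 _ _ _ _ _ h1 h4
    exact ⟨hf _ _ _ h2 h5, hf _ _ _ h3 h6⟩
  · intro b hb c hc
    obtain ⟨b', hb', h1⟩ := hs b hb
    obtain ⟨c', hc', h2⟩ := hs c hc
    obtain ⟨a, ha, h3⟩ := hH.2.2 _ hb' _ hc'
    exact ⟨a, ha.trans_le hνδ, _, _, h3, h1, h2⟩

/-- Comparison of the pairs `(a, b)` and `(c, d)` of ordinals by their maxima, with the maximum
spelled out so that the definition is visibly first-order. -/
def MaxLT (a b c d : Ordinal.{u}) : Prop := (a < c ∨ a < d) ∧ (b < c ∨ b < d)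

/-- Gödel's well-ordering of the pairs of ordinals: `(a, b)` precedes `(c, d)`. -/
def GodelLT (a b c d : Ordinal.{u}) : Prop :=
  MaxLT a b c d ∨ (¬ MaxLT c d a b ∧ (a < c ∨ (a = c ∧ b < d)))

theorem godelLT_iff {a b c d : Ordinal.{u}} : GodelLT a b c d ↔
    Prod.Lex (· < ·) (Prod.Lex (· < ·) (· < ·)) (max a b, a, b) (max c d, c, d) := by
  have h : ∀ a b c d : Ordinal.{u}, MaxLT a b c d ↔ max a b < max c d := by
    intro a b c d
    rw [MaxLT, max_lt_iff, lt_max_iff, lt_max_iff]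
  simp only [GodelLT, h, Prod.lex_def]
  constructor
  · rintro (h | ⟨h1, h2⟩)
    · exact Or.inl h
    · exact (lt_or_eq_of_le (not_lt.1 h1)).imp id fun h => ⟨h, h2⟩
  · rintro (h | ⟨h1, h2⟩)
    · exact Or.inl h
    · exact Or.inr ⟨h1.not_gt, h2⟩

instance Dfn.godelLT (a b c d : (Fin n → W) → Ordinal.{u}) [OTm a] [OTm b] [OTm c] [OTm d] :
    Dfn (fun v => GodelLT (a v) (b v) (c v) (d v)) := by
  simp only [GodelLT, MaxLT]
  infer_instance

instance Dfn.eqOpairToW (x : (Fin n → W) → W) (a b : (Fin n → W) → Ordinal.{u})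
    [Tm x] [OTm a] [OTm b] :
    Dfn (fun v => x v = InnerModel.opair (InnerModel.toW W (a v)) (InnerModel.toW W (b v))) := by
  refine Dfn.osubst (P := fun α v => x v =
    InnerModel.opair (InnerModel.toW W α) (InnerModel.toW W (b v))) a fun t ht => ?_
  refine Dfn.osubst (P := fun β v => x v = InnerModel.opair
    (InnerModel.toW W (InnerModel.ord (t v))) (InnerModel.toW W β)) b fun s hs => ?_
  have : Dfn (fun v : Fin 3 → W => ∃ p q : W, p = InnerModel.toW W (InnerModel.ord (v 1)) ∧
      q = InnerModel.toW W (InnerModel.ord (v 2)) ∧ v 0 = InnerModel.opair p q) := inferInstance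
  have h : Dfn (fun v : Fin 3 → W => v 0 = InnerModel.opair
      (InnerModel.toW W (InnerModel.ord (v 1))) (InnerModel.toW W (InnerModel.ord (v 2)))) :=
    this.congr fun v => by simp
  exact Dfn.subst₃ (P := fun x y z => x = InnerModel.opair
    (InnerModel.toW W (InnerModel.ord y)) (InnerModel.toW W (InnerModel.ord z))) h x t s

/-- Gödel's order of `δ × δ` has a definable rank function `ρ`, which is injective. Every ordinal
below `ρ b c` is the rank of a pair of ordinals up to `max b c`. -/
theorem exists_godelRank (W : Set ZFSet.{u}) [hW : Fact (IsInnerModel W)] (δ : Ordinal.{u}) :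
    ∃ ρ : Ordinal.{u} → Ordinal.{u} → Ordinal.{u},
      Dfn (W := W) (fun v : Fin 3 → W => ord (v 0) < δ ∧ ord (v 1) < δ ∧
        ord (v 2) = ρ (ord (v 0)) (ord (v 1))) ∧
      (∀ b < δ, ∀ c < δ, ∀ b' < δ, ∀ c' < δ, ρ b c = ρ b' c' → b = b' ∧ c = c') ∧
      ∀ b < δ, ∀ c < δ, ∀ γ < ρ b c, ∃ b' c', b' ≤ max b c ∧ c' ≤ max b c ∧ ρ b' c' = γ := by
  obtain ⟨X, hX⟩ := exists_prod (toW W δ) (toW W δ)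
  have hX' : ∀ b c, (opair (toW W b) (toW W c)).1 ∈ X.1 ↔ b < δ ∧ c < δ := by
    intro b c
    rw [hX]
    constructor
    · rintro ⟨x, y, hx, hy, h⟩
      obtain ⟨rfl, rfl⟩ := opair_inj.1 h
      exact ⟨toW_mem_toW.1 hx, toW_mem_toW.1 hy⟩
    · rintro ⟨hb, hc⟩
      exact ⟨_, _, toW_mem_toW.2 hb, toW_mem_toW.2 hc, rfl⟩
  let r : W → W → Prop := fun p q => ∃ b c b' c' : Ordinal.{u}, p = opair (toW W b) (toW W c) ∧
    q = opair (toW W b') (toW W c') ∧ b < δ ∧ c < δ ∧ GodelLT b c b' c'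
  have hr : ∀ b c b' c', r (opair (toW W b) (toW W c)) (opair (toW W b') (toW W c')) ↔
      b < δ ∧ c < δ ∧ GodelLT b c b' c' := by
    intro b c b' c'
    constructor
    · rintro ⟨d, e, d', e', h1, h2, h⟩
      simp only [opair_inj, toW_inj] at h1 h2
      rwa [h1.1, h1.2, h2.1, h2.2]
    · intro h
      exact ⟨b, c, b', c', rfl, rfl, h⟩
  have hG : WellFounded (fun p q : Ordinal.{u} × Ordinal.{u} => GodelLT p.1 p.2 q.1 q.2) := by
    have h : WellFounded (Prod.Lex (α := Ordinal.{u}) (· < ·) (Prod.Lex (α := Ordinal.{u})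
        (β := Ordinal.{u}) (· < ·) (· < ·))) :=
      wellFounded_lt.prod_lex (wellFounded_lt.prod_lex wellFounded_lt)
    exact Subrelation.wf (fun h => godelLT_iff.1 h)
      (InvImage.wf (fun p : Ordinal.{u} × Ordinal.{u} => (max p.1 p.2, p.1, p.2)) h)
  have hwf : WellFounded r := by
    have h0 : ∀ p : Ordinal.{u} × Ordinal.{u}, Acc r (opair (toW W p.1) (toW W p.2)) := by
      intro p
      induction p using hG.induction with
      | _ p ih =>
        refine ⟨_, fun q hq => ?_⟩
        obtain ⟨b, c, b', c', rfl, h, -, -, hlt⟩ := hq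
        simp only [opair_inj, toW_inj] at h
        rw [← h.1, ← h.2] at hlt
        exact ih (b, c) hlt
    refine ⟨fun q => ⟨_, fun p hp => ?_⟩⟩
    obtain ⟨b, c, b', c', rfl, -⟩ := hp
    exact h0 (b, c)
  have htr : ∀ x y z, r x y → r y z → r x z := by
    rintro x y z ⟨b, c, b', c', rfl, rfl, hb, hc, h⟩ h'
    obtain ⟨b₁, c₁, b₂, c₂, h1, rfl, hb', hc', h''⟩ := h'
    simp only [opair_inj, toW_inj] at h1
    obtain ⟨rfl, rfl⟩ := h1
    rw [hr]
    refine ⟨hb, hc, ?_⟩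
    rw [godelLT_iff] at h h'' ⊢
    exact _root_.trans h h''
  obtain ⟨ρ, hρ, hρ1, hρ2⟩ := exists_rank X r inferInstance
    (by rintro x y ⟨b, c, b', c', rfl, -, hb, hc, -⟩; exact (hX' b c).2 ⟨hb, hc⟩) hwf htr
  have iρ : ∀ {n : ℕ} (t s : (Fin n → W) → W) [Tm t] [Tm s],
      Dfn (fun v => (t v).1 ∈ X.1 ∧ ord (s v) = ρ (t v)) :=
    fun t s _ _ => Dfn.subst₂ (P := fun x y => x.1 ∈ X.1 ∧ ord y = ρ x) hρ t s
  refine ⟨fun b c => ρ (opair (toW W b) (toW W c)), ?_, ?_, ?_⟩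
  · have : Dfn (fun v : Fin 3 → W => ∃ x, x = opair (toW W (ord (v 0))) (toW W (ord (v 1))) ∧
        (x.1 ∈ X.1 ∧ ord (v 2) = ρ x)) :=
      Dfn.ex (fun x v => x = opair (toW W (ord (v 0))) (toW W (ord (v 1))) ∧
        (x.1 ∈ X.1 ∧ ord (v 2) = ρ x))
        (h := Dfn.and _ _ (hQ := iρ (fun w => w 0) (fun w => w 3)))
    refine this.congr fun v => ?_
    rw [exists_eq_left, hX', and_assoc]
  · intro b hb c hc b' hb' c' hc' h
    by_contra hne
    have : GodelLT b c b' c' ∨ GodelLT b' c' b c := by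
      rw [godelLT_iff, godelLT_iff]
      rcases trichotomous_of (Prod.Lex (α := Ordinal.{u}) (· < ·) (Prod.Lex (α := Ordinal.{u})
        (β := Ordinal.{u}) (· < ·) (· < ·))) (max b c, b, c) (max b' c', b', c') with h | h | h
      · exact Or.inl h
      · simp only [Prod.mk.injEq] at h
        exact (hne h.2).elim
      · exact Or.inr h
    rcases this with h' | h'
    · exact (hρ1 _ _ ((hr _ _ _ _).2 ⟨hb, hc, h'⟩)).ne h
    · exact (hρ1 _ _ ((hr _ _ _ _).2 ⟨hb', hc', h'⟩)).ne h.symm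
  · intro b hb c hc γ hγ
    obtain ⟨x, ⟨b', c', b₁, c₁, rfl, h, hb', hc', hlt⟩, hx⟩ := hρ2 _ γ hγ
    simp only [opair_inj, toW_inj] at h
    obtain ⟨rfl, rfl⟩ := h
    have : max b' c' ≤ max b c := by
      rw [godelLT_iff, Prod.lex_def] at hlt
      rcases hlt with h | h
      · exact h.le
      · exact h.1.le
    exact ⟨b', c', (le_max_left _ _).trans this, (le_max_right _ _).trans this, hx⟩

open Ordinal Cardinal in
/-- Hessenberg's theorem in `W`. If `δ` is covered by a smaller ordinal, then a pairing of that
ordinal is transferred to `δ`. Otherwise Gödel's order of `δ × δ` has rank at most `δ`, as a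
larger rank would cover `δ` by the pairs of ordinals up to some `max b c < δ`, hence by a smaller
ordinal. -/
theorem exists_pairing (δ : Ordinal.{u}) (hδ : ω ≤ δ) : ∃ H, IsPairing W δ H := by
  induction δ using WellFoundedLT.induction with
  | _ δ ih =>
    by_cases hcov : ∃ ν < δ, Covered W ν (· < δ)
    · obtain ⟨ν, hν, hc⟩ := hcov
      have : ω ≤ ν := by
        have := hc.card_le_card
        rw [← Ordinal.aleph0_le_card] at hδ ⊢
        exact hδ.trans this
      obtain ⟨H, hH⟩ := ih ν hν this
      exact hH.of_covered hc hν.le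
    · obtain ⟨ρ, hρ, hinj, hseg⟩ := exists_godelRank W δ
      have iρ : ∀ {n : ℕ} (t s r : (Fin n → W) → Ordinal.{u}) [OTm t] [OTm s] [OTm r],
          Dfn (fun v => t v < δ ∧ s v < δ ∧ r v = ρ (t v) (s v)) :=
        fun t s r _ _ _ => Dfn.osubst₃ (P := fun a b c => a < δ ∧ b < δ ∧ c = ρ a b) hρ t s r
      have hlt : ∀ b < δ, ∀ c < δ, ρ b c < δ := by
        intro b hb c hc
        by_contra hle
        rw [not_lt] at hle
        have hm : max b c < δ := max_lt hb hc
        have hsurj : ∀ γ < δ, ∃ b' c', b' ≤ max b c ∧ c' ≤ max b c ∧ ρ b' c' = γ :=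
          fun γ hγ => hseg b hb c hc γ (hγ.trans_le hle)
        rcases hδ.eq_or_lt with rfl | hδ'
        · -- below `ω` the initial segment is finite
          have hfin : (Iic (max b c)).Finite := by
            obtain ⟨k, hk⟩ := lt_omega0.1 hm
            rw [hk]
            refine ((Set.finite_Iic k).image (fun n : ℕ => (n : Ordinal.{u}))).subset ?_
            intro x hx
            obtain ⟨l, rfl⟩ := lt_omega0.1 (lt_of_le_of_lt hx (natCast_lt_omega0 k))
            exact ⟨l, by simpa using hx, rfl⟩
          have hinf : (Iio (ω : Ordinal.{u})).Infinite := by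
            refine Set.infinite_of_injective_forall_mem (f := fun n : ℕ => (n : Ordinal.{u}))
              Nat.cast_injective fun k => natCast_lt_omega0 k
          refine hinf (((hfin.prod hfin).image (fun p => ρ p.1 p.2)).subset fun γ hγ => ?_)
          obtain ⟨b', c', h1, h2, h3⟩ := hsurj γ hγ
          exact ⟨(b', c'), ⟨h1, h2⟩, h3⟩
        · have hν : max (max b c + 1) ω < δ := by
            have h1 : max b c + 1 ≤ δ := Order.add_one_le_of_lt hm
            refine max_lt (h1.lt_of_ne fun h => ?_) hδ'
            refine hcov ⟨max b c, hm, ?_⟩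
            rw [← h]
            refine covered_add_one ?_
            rw [← h] at hδ'
            exact Order.lt_add_one_iff.1 hδ'
          refine hcov ⟨max (max b c + 1) ω, hν, ?_⟩
          · obtain ⟨H, hH⟩ := ih (max (max b c + 1) ω) hν (le_max_right _ _)
            have iH : ∀ {n : ℕ} (t s r : (Fin n → W) → Ordinal.{u}) [OTm t] [OTm s] [OTm r],
              Dfn (fun v => H (t v) (s v) (r v)) := fun t s r _ _ _ => hH.1.osubst₃ t s r
            refine ⟨fun a γ => ∃ b' c', H a b' c' ∧ (b' < δ ∧ c' < δ ∧ γ = ρ b' c'),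
              inferInstance, ?_, ?_⟩
            · rintro a γ γ' ⟨b', c', h1, -, -, rfl⟩ ⟨b₁, c₁, h2, -, -, rfl⟩
              obtain ⟨rfl, rfl⟩ := hH.2.1 _ _ _ _ _ h1 h2
              rfl
            · intro γ hγ
              obtain ⟨b', c', hb', hc', rfl⟩ := hsurj γ hγ
              have h0 : max b c < max (max b c + 1) ω := (lt_add_one _).trans_le (le_max_left _ _)
              obtain ⟨a, ha, h⟩ := hH.2.2 b' (hb'.trans_lt h0) c' (hc'.trans_lt h0)
              exact ⟨a, ha, b', c', h, hb'.trans_lt hm, hc'.trans_lt hm, rfl⟩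
      refine ⟨fun a b c => b < δ ∧ c < δ ∧ a = ρ b c,
        iρ (fun v => ord (v 1)) (fun v => ord (v 2)) (fun v => ord (v 0)), ?_, ?_⟩
      · rintro a b c b' c' ⟨h1, h2, rfl⟩ ⟨h3, h4, h5⟩
        exact hinj _ h1 _ h2 _ h3 _ h4 h5
      · intro b hb c hc
        exact ⟨_, hlt b hb c hc, hb, hc, rfl⟩

/-! ### Collapses and uniform coverings -/

/-- The order isomorphism `ρ` of a definable bounded class of ordinals with an ordinal is
definable. -/
theorem exists_collapse (W : Set ZFSet.{u}) [hW : Fact (IsInnerModel W)]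
    (θ : Ordinal.{u}) (P : Ordinal.{u} → Prop)
    (hP : Dfn (W := W) (fun v : Fin 1 → W => P (ord (v 0)))) (hPθ : ∀ a, P a → a < θ) :
    ∃ ρ : Ordinal.{u} → Ordinal.{u},
      Dfn (W := W) (fun v : Fin 2 → W => P (ord (v 0)) ∧ ord (v 1) = ρ (ord (v 0))) ∧
      (∀ a b, P a → P b → a < b → ρ a < ρ b) ∧
      ∀ b, P b → ∀ γ < ρ b, ∃ a < b, P a ∧ ρ a = γ := by
  have iP : ∀ {n : ℕ} (t : (Fin n → W) → Ordinal.{u}) [OTm t], Dfn (fun v => P (t v)) :=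
    fun t _ => hP.osubst₁ t
  obtain ⟨ρ, hρ, hρ1, hρ2⟩ := exists_rank (toW W θ) (fun x y => ∃ a b : Ordinal.{u},
    x = toW W a ∧ y = toW W b ∧ P a ∧ P b ∧ a < b) inferInstance
    (by rintro x y ⟨a, b, rfl, rfl, ha, -⟩; exact toW_mem_toW.2 (hPθ a ha))
    (Subrelation.wf (r := fun x y : W => ord x < ord y)
      (by rintro x y ⟨a, b, rfl, rfl, -, -, h⟩; simpa using h) (InvImage.wf ord wellFounded_lt))
    (by
      rintro x y z ⟨a, b, rfl, rfl, ha, hb, h⟩ ⟨a', b', h1, rfl, ha', hb', h'⟩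
      obtain rfl := toW_inj.1 h1
      exact ⟨a, b', rfl, rfl, ha, hb', h.trans h'⟩)
  have iρ : ∀ {n : ℕ} (t s : (Fin n → W) → W) [Tm t] [Tm s],
      Dfn (fun v => (t v).1 ∈ (toW W θ).1 ∧ ord (s v) = ρ (t v)) :=
    fun t s _ _ => Dfn.subst₂ (P := fun x y => x.1 ∈ (toW W θ).1 ∧ ord y = ρ x) hρ t s
  refine ⟨fun a => ρ (toW W a), ?_, fun a b ha hb hab => hρ1 _ _ ⟨a, b, rfl, rfl, ha, hb, hab⟩, ?_⟩
  · have : Dfn (fun v : Fin 2 → W => P (ord (v 0)) ∧ ∃ x, x = toW W (ord (v 0)) ∧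
        (x.1 ∈ (toW W θ).1 ∧ ord (v 1) = ρ x)) :=
      Dfn.and _ _ (hQ := Dfn.ex (fun x v => x = toW W (ord (v 0)) ∧
        (x.1 ∈ (toW W θ).1 ∧ ord (v 1) = ρ x))
        (h := Dfn.and _ _ (hQ := iρ (fun w => w 0) (fun w => w 2))))
    refine this.congr fun v => and_congr_right fun h => ?_
    rw [exists_eq_left, toW_mem_toW]
    exact (and_iff_right (hPθ _ h)).symm
  · intro b hb γ hγ
    obtain ⟨x, ⟨a, b', rfl, h, ha, -, hab⟩, hx⟩ := hρ2 _ γ hγ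
    obtain rfl := toW_inj.1 h
    exact ⟨a, hab, ha, hx⟩

/-- Coverings by `ν` of the members of a definable family of classes can be chosen definably, by the
axiom of choice in `W`. -/
theorem exists_uniform_covering (ν θ : Ordinal.{u}) (P : Ordinal.{u} → Ordinal.{u} → Prop)
    (hP : Dfn (W := W) (fun v : Fin 2 → W => P (ord (v 0)) (ord (v 1))))
    (hPθ : ∀ γ b, P γ b → b < θ) :
    ∃ E : Ordinal.{u} → Ordinal.{u} → Ordinal.{u} → Prop,
      Dfn (W := W) (fun v : Fin 3 → W => E (ord (v 0)) (ord (v 1)) (ord (v 2))) ∧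
      (∀ γ a b b', E γ a b → E γ a b' → b = b') ∧
      ∀ γ, Covered W ν (P γ) → ∀ b, P γ b → ∃ a < ν, E γ a b := by
  have iP : ∀ {n : ℕ} (t s : (Fin n → W) → Ordinal.{u}) [OTm t] [OTm s],
    Dfn (fun v => P (t v) (s v)) := fun t s _ _ => hP.osubst₂ t s
  obtain ⟨q, hq⟩ := exists_prod (toW W ν) (toW W θ)
  obtain ⟨B, hB⟩ := exists_powerset q
  obtain ⟨Q, hQ, hQ1, hQ2, hQ3⟩ := exists_uniformization B (fun x y => Covers y ν (P (ord x)))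
    (by unfold Covers; infer_instance)
  have iQ : ∀ {n : ℕ} (t s : (Fin n → W) → W) [Tm t] [Tm s],
    Dfn (fun v => Q (t v) (s v)) := fun t s _ _ => hQ.subst₂ t s
  refine ⟨fun γ a b => ∃ x, x = toW W γ ∧ ∃ y, Q x y ∧ orel y a b, inferInstance, ?_, ?_⟩
  · rintro γ a b b' ⟨x, rfl, y, hy, h⟩ ⟨x', rfl, y', hy', h'⟩
    obtain rfl := hQ2 _ _ _ hy hy'
    exact (hQ1 _ _ hy).1 _ _ _ h h'
  · intro γ hγ b hb
    obtain ⟨y, hy, hyc⟩ := hγ.exists_covers θ (hPθ γ)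
    have hyB : y.1 ∈ B.1 := by
      refine (hB y).2 fun p hp => (hq p).2 ?_
      obtain ⟨α, hα, β, hβ, h⟩ := hy p hp
      exact ⟨_, _, toW_mem_toW.2 hα, toW_mem_toW.2 hβ, h⟩
    obtain ⟨z, hz⟩ := hQ3 (toW W γ) ⟨y, hyB, by simpa using hyc⟩
    have := (hQ1 _ _ hz).2 b (by simpa using hb)
    obtain ⟨a, ha, h⟩ := this
    exact ⟨a, ha, _, rfl, z, hz, h⟩

theorem covered_of_isBijection {α β : Ordinal.{u}} {f : ZFSet.{u}} (hf : f ∈ W)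
    (h : IsBijection α.toZFSet β.toZFSet f) : Covered W α (· < β) := by
  obtain ⟨⟨hsub, hfun⟩, hsurj⟩ := h
  refine ⟨orel ⟨f, hf⟩, inferInstance, fun a b b' h h' => ?_, fun b hb => ?_⟩
  · have h1 : ZFSet.pair a.toZFSet b.toZFSet ∈ f := h
    have h2 : ZFSet.pair a.toZFSet b'.toZFSet ∈ f := h'
    have ha := (ZFSet.pair_mem_prod.1 (hsub h1)).1
    exact Ordinal.toZFSet_injective ((hfun _ ha).unique h1 h2)
  · obtain ⟨z, ⟨hz, hzf⟩, -⟩ := hsurj _ (Ordinal.toZFSet_mem_toZFSet_iff.2 hb)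
    obtain ⟨a, ha, rfl⟩ := Ordinal.mem_toZFSet_iff.1 hz
    exact ⟨a, ha, hzf⟩

/-- The ordinals below the successor cardinal of `κ` in `W` have, in `W`, size at most `κ`. -/
theorem covered_of_lt_succCardinal {κ δ : Ordinal.{u}} (h : IsSuccCardinalIn W κ δ) :
    ∀ β < δ, Covered W κ (· < β) := by
  intro β
  induction β using WellFoundedLT.induction with
  | _ β ih =>
    intro hβ
    rcases le_or_gt β κ with hle | hlt
    · exact (covered_self κ).mono fun b hb => hb.trans_le hle
    · have : ¬ IsCardinalIn W β := fun hc => (h.2 ⟨hlt, hc⟩).not_gt hβ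
      simp only [IsCardinalIn, not_forall, not_not] at this
      obtain ⟨α, hα, f, hf, hb⟩ := this
      exact (ih α hα (hα.trans hβ)).trans (covered_of_isBijection hf hb)

/-- There is a definable family of partial functions `E β`, for `β` below the successor cardinal of
`κ` in `W`, with `E β` mapping part of `κ` onto a set that includes `β`. -/
theorem exists_enumerations {κ δ : Ordinal.{u}} (h : IsSuccCardinalIn W κ δ) :
    ∃ E : Ordinal.{u} → Ordinal.{u} → Ordinal.{u} → Prop,
      Dfn (W := W) (fun v : Fin 3 → W => E (ord (v 0)) (ord (v 1)) (ord (v 2))) ∧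
      (∀ γ a b b', E γ a b → E γ a b' → b = b') ∧
      ∀ β < δ, ∀ b < β, ∃ a < κ, E β a b := by
  obtain ⟨E, hE, hf, hs⟩ := exists_uniform_covering (W := W) κ δ (fun β b => β < δ ∧ b < β)
    inferInstance (fun β b h => h.2.trans h.1)
  refine ⟨E, hE, hf, fun β hβ b hb => hs β ?_ b ⟨hβ, hb⟩⟩
  exact (covered_of_lt_succCardinal h β hβ).mono fun b hb => hb.2

/-! ### Hulls -/

/-- `ξ` is in the least set of `W` that includes the part of `β` enumerated by `E β` up to `δ`,
and with each `γ` the part of `γ` enumerated by `E γ` up to `δ`. Here `E γ b η` says that `η` is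
the `b`-th element in the enumeration of `γ`. The closure makes hulls transitive: see
`Hull.trans`. -/
def Hull (W : Set ZFSet.{u}) [hW : Fact (IsInnerModel W)]
    (E : Ordinal.{u} → Ordinal.{u} → Ordinal.{u} → Prop) (δ β ξ : Ordinal.{u}) : Prop :=
  ∀ D : W, (∀ η < β, (∃ b ≤ δ, E β b η) → omem D η) →
    (∀ γ, omem D γ → ∀ η < γ, (∃ b ≤ δ, E γ b η) → omem D η) → omem D ξ

section Hull

variable {E : Ordinal.{u} → Ordinal.{u} → Ordinal.{u} → Prop}

theorem dfn_hull (hE : Dfn (W := W) (fun v : Fin 3 → W => E (ord (v 0)) (ord (v 1)) (ord (v 2)))) :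
    Dfn (W := W) (fun v : Fin 3 → W => Hull W E (ord (v 0)) (ord (v 1)) (ord (v 2))) := by
  have iE : ∀ {n : ℕ} (t s r : (Fin n → W) → Ordinal.{u}) [OTm t] [OTm s] [OTm r],
    Dfn (fun v => E (t v) (s v) (r v)) := fun t s r _ _ _ => hE.osubst₃ t s r
  unfold Hull
  infer_instance

theorem omem_toW {α β : Ordinal.{u}} : omem (toW W α) β ↔ β < α := toW_mem_toW

theorem Hull.lt {δ β ξ : Ordinal.{u}} (h : Hull W E δ β ξ) : ξ < β :=
  omem_toW.1 (h (toW W β) (fun _ hη _ => omem_toW.2 hη)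
    fun _ hγ _ hη _ => omem_toW.2 (hη.trans (omem_toW.1 hγ)))

theorem Hull.base {δ β η b : Ordinal.{u}} (hη : η < β) (hb : b ≤ δ) (h : E β b η) :
    Hull W E δ β η := fun _ h1 _ => h1 η hη ⟨b, hb, h⟩

theorem Hull.trans {δ β γ η : Ordinal.{u}} (h : Hull W E δ β γ) (h' : Hull W E δ γ η) :
    Hull W E δ β η :=
  fun D h1 h2 => h' D (fun η hη hb => h2 γ (h D h1 h2) η hη hb) h2

theorem Hull.mono {δ δ' β ξ : Ordinal.{u}} (h : Hull W E δ β ξ) (hδ : δ ≤ δ') :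
    Hull W E δ' β ξ :=
  fun D h1 h2 => h D (fun _ hη ⟨b, hb, h⟩ => h1 _ hη ⟨b, hb.trans hδ, h⟩)
    fun _ hγ _ hη ⟨b, hb, h⟩ => h2 _ hγ _ hη ⟨b, hb.trans hδ, h⟩

/-- An element of the hull of `β` is enumerated by `E β` up to `δ`, or is in the hull of an ordinal
that is. This holds because the ordinals with this property have the closure properties in the
definition of the hull. -/
theorem Hull.cases (hE : Dfn (W := W) (fun v : Fin 3 → W => E (ord (v 0)) (ord (v 1)) (ord (v 2))))
    {δ β ξ : Ordinal.{u}} (h : Hull W E δ β ξ) :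
    ∃ γ < β, (∃ b ≤ δ, E β b γ) ∧ (ξ = γ ∨ Hull W E δ γ ξ) := by
  have iE : ∀ {n : ℕ} (t s r : (Fin n → W) → Ordinal.{u}) [OTm t] [OTm s] [OTm r],
    Dfn (fun v => E (t v) (s v) (r v)) := fun t s r _ _ _ => hE.osubst₃ t s r
  have iH : ∀ {n : ℕ} (t s r : (Fin n → W) → Ordinal.{u}) [OTm t] [OTm s] [OTm r],
    Dfn (fun v => Hull W E (t v) (s v) (r v)) := fun t s r _ _ _ => (dfn_hull hE).osubst₃ t s r
  obtain ⟨D, -, hD⟩ := exists_oset (W := W) β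
    (fun ξ => ∃ γ < β, (∃ b ≤ δ, E β b γ) ∧ (ξ = γ ∨ Hull W E δ γ ξ)) inferInstance
  refine ((hD ξ).1 (h D (fun η hη hb => (hD η).2 ⟨hη, η, hη, hb, Or.inl rfl⟩) ?_)).2
  intro γ hγ η hη ⟨b, hb, hbE⟩
  obtain ⟨hγβ, γ', hγ', hb', h'⟩ := (hD γ).1 hγ
  refine (hD η).2 ⟨hη.trans hγβ, γ', hγ', hb', Or.inr ?_⟩
  have h0 : Hull W E δ γ η := Hull.base hη hb hbE
  rcases h' with rfl | h'
  · exact h0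
  · exact h'.trans h0

open Ordinal in
/-- The hulls with bound `δ` have size at most `δ + 1` in `W`, by induction on `β`. -/
theorem covered_hull
    (hE : Dfn (W := W) (fun v : Fin 3 → W => E (ord (v 0)) (ord (v 1)) (ord (v 2))))
    (hEf : ∀ γ a b b', E γ a b → E γ a b' → b = b') {δ : Ordinal.{u}} (hδ : ω ≤ δ)
    (β : Ordinal.{u}) : Covered W (δ + 1) (Hull W E δ β) := by
  have iE : ∀ {n : ℕ} (t s r : (Fin n → W) → Ordinal.{u}) [OTm t] [OTm s] [OTm r],
    Dfn (fun v => E (t v) (s v) (r v)) := fun t s r _ _ _ => hE.osubst₃ t s r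
  have iH : ∀ {n : ℕ} (t s r : (Fin n → W) → Ordinal.{u}) [OTm t] [OTm s] [OTm r],
    Dfn (fun v => Hull W E (t v) (s v) (r v)) := fun t s r _ _ _ => (dfn_hull hE).osubst₃ t s r
  obtain ⟨H, hH⟩ := exists_pairing (W := W) (δ + 1) (hδ.trans le_self_add)
  have iP : ∀ {n : ℕ} (t s r : (Fin n → W) → Ordinal.{u}) [OTm t] [OTm s] [OTm r],
    Dfn (fun v => H (t v) (s v) (r v)) := fun t s r _ _ _ => hH.1.osubst₃ t s r
  induction β using WellFoundedLT.induction with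
  | _ β ih =>
    obtain ⟨G, hG, hGf, hGs⟩ := exists_uniform_covering (W := W) (δ + 1) β
      (fun γ ξ => γ < β ∧ Hull W E δ γ ξ) inferInstance (fun γ ξ h => h.2.lt.trans h.1)
    have iG : ∀ {n : ℕ} (t s r : (Fin n → W) → Ordinal.{u}) [OTm t] [OTm s] [OTm r],
      Dfn (fun v => G (t v) (s v) (r v)) := fun t s r _ _ _ => hG.osubst₃ t s r
    -- `ξ` is coded by `((b₁, b₂), c)`: `b₁` yields `γ`, and `ξ` is `γ` or the `c`-th element of the
    -- hull of `γ`, as `b₂` tells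
    refine ⟨fun a ξ => ∃ b c, H a b c ∧ ∃ b₁ b₂, H b b₁ b₂ ∧ ∃ γ, E β b₁ γ ∧
      ((b₂ = 0 ∧ ξ = γ) ∨ (¬ b₂ = 0 ∧ G γ c ξ)), inferInstance, ?_, ?_⟩
    · rintro a ξ ξ' ⟨b, c, h1, b₁, b₂, h2, γ, h3, h⟩ ⟨b', c', h1', b₁', b₂', h2', γ', h3', h'⟩
      obtain ⟨rfl, rfl⟩ := hH.2.1 _ _ _ _ _ h1 h1'
      obtain ⟨rfl, rfl⟩ := hH.2.1 _ _ _ _ _ h2 h2'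
      obtain rfl := hEf _ _ _ _ h3 h3'
      rcases h with ⟨h, rfl⟩ | ⟨h, hg⟩ <;> rcases h' with ⟨h', rfl⟩ | ⟨h', hg'⟩
      · rfl
      · exact (h' h).elim
      · exact (h h').elim
      · exact hGf _ _ _ _ hg hg'
    · intro ξ hξ
      obtain ⟨γ, hγ, ⟨b₁, hb₁, hbE⟩, h⟩ := hξ.cases hE
      have h0 : (0 : Ordinal.{u}) < δ + 1 := by simp
      have h1 : (1 : Ordinal.{u}) < δ + 1 :=
        (one_lt_omega0.trans_le hδ).trans_le le_self_add
      have hb : b₁ < δ + 1 := Order.lt_add_one_iff.2 hb₁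
      rcases h with rfl | h
      · obtain ⟨b, hb, hbc⟩ := hH.2.2 _ hb _ h0
        obtain ⟨a, ha, hac⟩ := hH.2.2 _ hb _ h0
        exact ⟨a, ha, b, 0, hac, b₁, 0, hbc, ξ, hbE, Or.inl ⟨rfl, rfl⟩⟩
      · obtain ⟨c, hc, hcG⟩ := hGs γ ((ih γ hγ).mono fun b hb => hb.2) ξ ⟨hγ, h⟩
        obtain ⟨b, hb, hbc⟩ := hH.2.2 _ hb _ h1
        obtain ⟨a, ha, hac⟩ := hH.2.2 _ hb _ hc
        exact ⟨a, ha, b, c, hac, b₁, 1, hbc, γ, hbE, Or.inr ⟨one_ne_zero, hcG⟩⟩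

end Hull

/-! ### Definable sequences of ordinals -/

/-- The sequence `s` of ordinals is definable over `W`. -/
def DfnSeq (W : Set ZFSet.{u}) (s : ℕ → Ordinal.{u}) : Prop :=
  Dfn (W := W) (fun v : Fin 2 → W => ∃ k : ℕ, ord (v 0) = k ∧ ord (v 1) = s k)

open Cardinal Ordinal in
/-- If `W` contains all countably infinite subsets of `μ`, then double sequences in `μ` are
definable: the set of the codes of all triples `(k, l, s k l)` is such a subset. -/
theorem dfn_double_seq {μ : Ordinal.{u}} (hμ : ω ≤ μ)
    (hb : ∀ x ⊆ μ.toZFSet, x.card = Cardinal.aleph0 → x ∈ W)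
    (s : ℕ → ℕ → Ordinal.{u}) (hs : ∀ k l, s k l < μ) :
    Dfn (W := W) (fun v : Fin 3 → W => ∃ k l : ℕ, ord (v 0) = k ∧ ord (v 1) = l ∧
      ord (v 2) = s k l) := by
  obtain ⟨H, hH⟩ := exists_pairing (W := W) μ hμ
  have iP : ∀ {n : ℕ} (t s r : (Fin n → W) → Ordinal.{u}) [OTm t] [OTm s] [OTm r],
    Dfn (fun v => H (t v) (s v) (r v)) := fun t s r _ _ _ => hH.1.osubst₃ t s r
  have hnat : ∀ k : ℕ, (k : Ordinal.{u}) < μ := fun k => (natCast_lt_omega0 k).trans_le hμ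
  choose c hc hcH using fun k l : ℕ => hH.2.2 _ (hnat k) _ (hnat l)
  choose a ha haH using fun k l : ℕ => hH.2.2 _ (hc k l) _ (hs k l)
  have hinj : Function.Injective (fun p : ℕ × ℕ => a p.1 p.2) := by
    rintro ⟨k, l⟩ ⟨k', l'⟩ h
    have h1 := haH k l
    rw [show a k l = a k' l' from h] at h1
    have h2 := hcH k l
    rw [(hH.2.1 _ _ _ _ _ h1 (haH k' l')).1] at h2
    have h3 := hH.2.1 _ _ _ _ _ h2 (hcH k' l')
    simpa using h3
  have hinj' : Function.Injective (fun p : ℕ × ℕ => (a p.1 p.2).toZFSet) :=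
    Ordinal.toZFSet_injective.comp hinj
  have hx : ZFSet.range (fun p : ℕ × ℕ => (a p.1 p.2).toZFSet) ∈ W := by
    refine hb _ ?_ ?_
    · intro z hz
      obtain ⟨p, rfl⟩ := ZFSet.mem_range.1 hz
      exact Ordinal.toZFSet_mem_toZFSet_iff.2 (ha _ _)
    · rw [← Cardinal.lift_inj.{u, u + 1}, ← ZFSet.cardinalMk_coe_sort]
      have h := Cardinal.mk_range_eq_of_injective hinj'
      rw [← ZFSet.coe_range, show #(ℕ × ℕ) = ℵ₀ by simp, Cardinal.lift_uzero,
        Cardinal.lift_aleph0] at h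
      rw [Cardinal.lift_aleph0]
      exact h
  have : Dfn (W := W) (fun v : Fin 3 → W => ∃ α β : Ordinal.{u},
      omem ⟨_, hx⟩ α ∧ H α β (ord (v 2)) ∧ H β (ord (v 0)) (ord (v 1))) := inferInstance
  refine this.congr fun v => ?_
  constructor
  · rintro ⟨k, l, h1, h2, h3⟩
    rw [h1, h2, h3]
    exact ⟨a k l, c k l, ZFSet.mem_range.2 ⟨(k, l), rfl⟩, haH k l, hcH k l⟩
  · rintro ⟨α, β, hα, h1, h2⟩
    obtain ⟨⟨k, l⟩, h⟩ := ZFSet.mem_range.1 hα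
    obtain rfl := Ordinal.toZFSet_injective h
    obtain ⟨rfl, h3⟩ := hH.2.1 _ _ _ _ _ h1 (haH k l)
    obtain ⟨h4, h5⟩ := hH.2.1 _ _ _ _ _ h2 (hcH k l)
    exact ⟨k, l, h4, h5, h3⟩

open Cardinal Ordinal in
theorem dfnSeq_of_lt {μ : Ordinal.{u}} (hμ : ω ≤ μ)
    (hb : ∀ x ⊆ μ.toZFSet, x.card = Cardinal.aleph0 → x ∈ W)
    (s : ℕ → Ordinal.{u}) (hs : ∀ k, s k < μ) : DfnSeq W s := by
  have h := dfn_double_seq hμ hb (fun k _ => s k) fun k _ => hs k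
  have i : ∀ {n : ℕ} (t r q : (Fin n → W) → Ordinal.{u}) [OTm t] [OTm r] [OTm q],
      Dfn (fun v => ∃ k l : ℕ, t v = k ∧ r v = l ∧ q v = s k) :=
    fun t r q _ _ _ => Dfn.osubst₃ (P := fun a b c => ∃ k l : ℕ, a = k ∧ b = l ∧ c = s k) h t r q
  have := i (n := 2) (fun v => ord (v 0)) (fun _ => 0) (fun v => ord (v 1))
  refine this.congr fun v => ?_
  constructor
  · rintro ⟨k, h1, h2⟩
    exact ⟨k, 0, h1, by simp, h2⟩
  · rintro ⟨k, l, h1, -, h2⟩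
    exact ⟨k, h1, h2⟩

/-- The image of a definable sequence under a definable relation that is functional on its terms is
definable. -/
theorem DfnSeq.map {s t : ℕ → Ordinal.{u}} (ht : DfnSeq W t)
    (R : Ordinal.{u} → Ordinal.{u} → Prop)
    (hR : Dfn (W := W) (fun v : Fin 2 → W => R (ord (v 0)) (ord (v 1))))
    (hf : ∀ k b, R (t k) b ↔ b = s k) : DfnSeq W s := by
  have iR : ∀ {n : ℕ} (t s : (Fin n → W) → Ordinal.{u}) [OTm t] [OTm s],
    Dfn (fun v => R (t v) (s v)) := fun t s _ _ => hR.osubst₂ t s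
  have it : ∀ {n : ℕ} (r q : (Fin n → W) → Ordinal.{u}) [OTm r] [OTm q],
    Dfn (fun v => ∃ k : ℕ, r v = k ∧ q v = t k) :=
    fun r q _ _ => Dfn.osubst₂ (P := fun a b => ∃ k : ℕ, a = k ∧ b = t k) ht r q
  have : Dfn (W := W) (fun v : Fin 2 → W => ∃ γ : Ordinal.{u},
      (∃ k : ℕ, ord (v 0) = k ∧ γ = t k) ∧ R γ (ord (v 1))) :=
    Dfn.oex (fun γ v => (∃ k : ℕ, ord (v 0) = k ∧ γ = t k) ∧ R γ (ord (v 1)))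
      (h := Dfn.and _ _ (hP := it (fun w => ord (w 1)) (fun w => ord (w 0))))
  refine this.congr fun v => ?_
  constructor
  · rintro ⟨k, h1, h2⟩
    exact ⟨_, ⟨k, h1, rfl⟩, (hf k _).2 h2⟩
  · rintro ⟨γ, ⟨k, h1, rfl⟩, h2⟩
    exact ⟨k, h1, (hf k _).1 h2⟩

open Ordinal in
/-- A sequence that is not in `W` is not even definable over `W`. -/
theorem exists_seq_of_hasNewSequence {κ : Ordinal.{u}} (h : HasNewSequence W κ) :
    ∃ s : ℕ → Ordinal.{u}, (∀ k, s k < κ) ∧ ¬ DfnSeq W s := by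
  obtain ⟨f, ⟨hsub, hf⟩, hfW⟩ := h
  have h1 : ∀ k : ℕ, ∃ α < κ, ZFSet.pair (k : Ordinal.{u}).toZFSet α.toZFSet ∈ f ∧
      ∀ w, ZFSet.pair (k : Ordinal.{u}).toZFSet w ∈ f → w = α.toZFSet := by
    intro k
    obtain ⟨w, hw, hu⟩ := hf _ (Ordinal.toZFSet_mem_toZFSet_iff.2 (natCast_lt_omega0 k))
    obtain ⟨α, hα, rfl⟩ := Ordinal.mem_toZFSet_iff.1 (ZFSet.pair_mem_prod.1 (hsub hw)).2
    exact ⟨α, hα, hw, hu⟩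
  choose s hs hsf hsu using h1
  refine ⟨s, hs, fun hd => hfW ?_⟩
  obtain ⟨z, hz, hz'⟩ := exists_orel (W := W) ω κ (fun a b => ∃ k : ℕ, a = k ∧ b = s k) hd
  have : z.1 = f := by
    ext p
    constructor
    · intro hp
      obtain ⟨α, hα, β, hβ, h⟩ := hz ⟨p, mem_of_mem z.2 hp⟩ hp
      have h' : orel z α β := by
        rw [orel, rel, ← h]; exact hp
      obtain ⟨-, -, k, rfl, rfl⟩ := (hz' _ _).1 h'
      have := hsf k
      rw [Subtype.ext_iff] at h
      rwa [show p = _ from h]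
    · intro hp
      obtain ⟨a, ha, b, hb, rfl⟩ := ZFSet.mem_prod.1 (hsub hp)
      obtain ⟨α, hα, rfl⟩ := Ordinal.mem_toZFSet_iff.1 ha
      obtain ⟨k, rfl⟩ := lt_omega0.1 hα
      rw [hsu k b hp]
      exact (hz' _ _).2 ⟨hα, hs k, k, rfl, rfl⟩
  exact this ▸ z.2

open Cardinal Ordinal in
/-- The number of sequences in an ordinal below `κ` is at most `κ`: otherwise `W` would have an
injection of `κ` into the set of these sequences, and sequences in `κ` could be coded by double
sequences in a smaller ordinal. -/
theorem mk_seq_le {κ μ : Ordinal.{u}} (hμ : ω ≤ μ)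
    (hb : ∀ x ⊆ μ.toZFSet, x.card = Cardinal.aleph0 → x ∈ W)
    {s : ℕ → Ordinal.{u}} (hsκ : ∀ k, s k < κ) (hs : ¬ DfnSeq W s) :
    #(ℕ → Iio μ) ≤ Cardinal.lift.{u + 1} κ.card := by
  obtain ⟨q, hq⟩ := exists_prod (toW W ω) (toW W μ)
  obtain ⟨B, hB⟩ := exists_powerset q
  obtain ⟨g, θ, hgf, hgs⟩ := exists_enum B
  -- `ξ` is the least index of the sequence coded by `y`
  let P : Ordinal.{u} → W → Prop := fun ξ y => ξ < θ ∧ rel g (toW W ξ) y ∧ y.1 ∈ B.1 ∧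
    (∀ η < ξ, ¬ rel g (toW W η) y) ∧ ∀ a < ω, ∃ b < μ, ∀ b', orel y a b' ↔ b' = b
  have iP0 : Dfn (W := W) (fun v : Fin 2 → W => P (ord (v 0)) (v 1)) := by
    simp only [P]; infer_instance
  have iP : ∀ {n : ℕ} (t : (Fin n → W) → Ordinal.{u}) (r : (Fin n → W) → W) [OTm t] [Tm r],
      Dfn (fun v => P (t v) (r v)) := fun t r _ _ =>
    Dfn.osubst (P := fun α v => P α (r v)) t fun t' _ =>
      Dfn.subst₂ (P := fun x y => P (ord x) y) iP0 t' r
  have hyex : ∀ f : ℕ → Iio μ, ∃ y : W, (∃ ξ, P ξ y) ∧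
      ∀ (k : ℕ) (b : Ordinal.{u}), orel y k b ↔ b = f k := by
    intro f
    have hd := dfnSeq_of_lt hμ hb (fun k => (f k).1) fun k => (f k).2
    obtain ⟨z, hz, hz'⟩ := exists_orel (W := W) ω μ (fun a b => ∃ k : ℕ, a = k ∧ b = f k) hd
    have hzB : z.1 ∈ B.1 := by
      refine (hB z).2 fun p hp => (hq p).2 ?_
      obtain ⟨α, hα, β, hβ, h⟩ := hz p hp
      exact ⟨_, _, toW_mem_toW.2 hα, toW_mem_toW.2 hβ, h⟩
    have hzf : ∀ (k : ℕ) (b : Ordinal.{u}), orel z k b ↔ b = f k := by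
      intro k b
      rw [hz']
      constructor
      · rintro ⟨-, -, k', h, rfl⟩
        rw [Nat.cast_inj.1 h]
      · rintro rfl
        exact ⟨natCast_lt_omega0 k, (f k).2, k, rfl, rfl⟩
    obtain ⟨α, hα, hαg⟩ := hgs z hzB
    have hαm : α ∈ {ξ | rel g (toW W ξ) z} := hαg
    have hne : {ξ | rel g (toW W ξ) z}.Nonempty := ⟨α, hαm⟩
    have hmin : rel g (toW W (sInf {ξ | rel g (toW W ξ) z})) z := by
      have := csInf_mem hne
      exact this
    refine ⟨z, ⟨sInf {ξ | rel g (toW W ξ) z}, ?_, hmin, hzB, ?_, ?_⟩, hzf⟩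
    · exact (csInf_le' hαm).trans_lt hα
    · intro η hη h
      exact notMem_of_lt_csInf' hη h
    · intro a ha
      obtain ⟨k, rfl⟩ := lt_omega0.1 ha
      exact ⟨f k, (f k).2, hzf k⟩
  choose y hy hyf using hyex
  choose ξ hξ using hy
  have hξinj : Function.Injective ξ := by
    intro f f' h
    have h1 := (hξ f).2.1
    rw [h] at h1
    have h2 := hgf _ _ _ h1 (hξ f').2.1
    ext k
    have := (hyf f k (f k)).2 rfl
    rw [h2] at this
    exact (hyf f' k _).1 this
  obtain ⟨ρ, hρ, hρ1, hρ2⟩ := exists_collapse W θ (fun ξ => ∃ y, P ξ y) inferInstance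
    (fun ξ ⟨y, h⟩ => h.1)
  by_cases hall : ∀ γ < κ, ∃ ξ, (∃ y, P ξ y) ∧ ρ ξ = γ
  · -- then every sequence in `κ` is definable
    exfalso
    apply hs
    choose x hx hxs using fun k => hall (s k) (hsκ k)
    choose y hy using hx
    have hval : ∀ k l : ℕ, ∃ b < μ, ∀ b', orel (y k) l b' ↔ b' = b :=
      fun k l => (hy k).2.2.2.2 l (natCast_lt_omega0 l)
    choose t htμ ht using hval
    have hd := dfn_double_seq hμ hb t htμ
    have it : ∀ {n : ℕ} (r q p : (Fin n → W) → Ordinal.{u}) [OTm r] [OTm q] [OTm p],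
        Dfn (fun v => ∃ k l : ℕ, r v = k ∧ q v = l ∧ p v = t k l) :=
      fun r q p _ _ _ => Dfn.osubst₃ (P := fun a b c => ∃ k l : ℕ, a = k ∧ b = l ∧ c = t k l)
        hd r q p
    have iρ : ∀ {n : ℕ} (r q : (Fin n → W) → Ordinal.{u}) [OTm r] [OTm q],
        Dfn (fun v => (∃ y, P (r v) y) ∧ q v = ρ (r v)) :=
      fun r q _ _ => Dfn.osubst₂ (P := fun a b => (∃ y, P a y) ∧ b = ρ a) hρ r q
    have : Dfn (W := W) (fun v : Fin 2 → W => ord (v 0) < ω ∧ ∃ ξ : Ordinal.{u},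
        ((∃ y, P ξ y) ∧ ord (v 1) = ρ ξ) ∧ ∃ y, P ξ y ∧ ∀ l < ω, ∀ b,
          (orel y l b ↔ ∃ k m : ℕ, ord (v 0) = k ∧ l = m ∧ b = t k m)) := by
      infer_instance
    refine this.congr fun v => ?_
    constructor
    · rintro ⟨k, h1, h2⟩
      rw [h1, h2]
      refine ⟨natCast_lt_omega0 k, x k, ⟨⟨y k, hy k⟩, (hxs k).symm⟩, y k, hy k, fun l hl b => ?_⟩
      obtain ⟨m, rfl⟩ := lt_omega0.1 hl
      rw [ht]
      constructor
      · rintro rfl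
        exact ⟨k, m, rfl, rfl, rfl⟩
      · rintro ⟨k', m', h3, h4, rfl⟩
        rw [Nat.cast_inj.1 h3, Nat.cast_inj.1 h4]
    · rintro ⟨h0, ξ', ⟨-, h1⟩, y', hy', h2⟩
      obtain ⟨k, hk⟩ := lt_omega0.1 h0
      refine ⟨k, hk, ?_⟩
      have hyy : y' = y k := by
        have key : ∀ z z' : W, z.1 ∈ B.1 → (∀ l < ω, ∀ b, orel z l b → orel z' l b) →
            ∀ p : W, p.1 ∈ z.1 → p.1 ∈ z'.1 := by
          intro z z' hz h p hp
          obtain ⟨a, b, ha, hb, rfl⟩ := (hq p).1 ((hB z).1 hz p hp)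
          obtain ⟨α, hα, rfl⟩ := eq_toW_of_mem ha
          obtain ⟨β, hβ, rfl⟩ := eq_toW_of_mem hb
          exact h α hα β hp
        have hiff : ∀ l < ω, ∀ b, orel y' l b ↔ orel (y k) l b := by
          intro l hl b
          rw [h2 l hl b]
          obtain ⟨m, rfl⟩ := lt_omega0.1 hl
          rw [ht]
          constructor
          · rintro ⟨k', m', h3, h4, rfl⟩
            rw [hk] at h3
            rw [Nat.cast_inj.1 h3, Nat.cast_inj.1 h4]
          · rintro rfl
            exact ⟨k, m, hk, rfl, rfl⟩
        exact hW.out.zfc.extensionality _ _ fun p =>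
          ⟨key _ _ hy'.2.2.1 (fun l hl b => (hiff l hl b).1) p,
            key _ _ (hy k).2.2.1 (fun l hl b => (hiff l hl b).2) p⟩
      subst hyy
      have : ξ' = x k := by
        rcases lt_trichotomy ξ' (x k) with h | h | h
        · exact ((hy k).2.2.2.1 _ h hy'.2.1).elim
        · exact h
        · exact (hy'.2.2.2.1 _ h (hy k).2.1).elim
      rw [h1, this, hxs]
  · push Not at hall
    obtain ⟨γ, hγκ, hγ⟩ := hall
    have hlt : ∀ f, ρ (ξ f) < γ := by
      intro f
      by_contra hle
      rcases (not_lt.1 hle).eq_or_lt with h | h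
      · exact hγ _ ⟨_, hξ f⟩ h.symm
      · obtain ⟨a, -, ha, h'⟩ := hρ2 _ ⟨_, hξ f⟩ γ h
        exact hγ a ha h'
    rw [← Cardinal.mk_Iio_ordinal]
    refine Cardinal.mk_le_of_injective
      (f := fun f => (⟨ρ (ξ f), (hlt f).trans hγκ⟩ : Iio κ)) fun f f' h => hξinj ?_
    have h' : ρ (ξ f) = ρ (ξ f') := Subtype.ext_iff.1 h
    rcases lt_trichotomy (ξ f) (ξ f') with h1 | h1 | h1
    · exact ((hρ1 _ _ ⟨_, hξ f⟩ ⟨_, hξ f'⟩ h1).ne h').elim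
    · exact h1
    · exact ((hρ1 _ _ ⟨_, hξ f'⟩ ⟨_, hξ f⟩ h1).ne h'.symm).elim

/-! ### The covering matrix of hulls -/

open Cardinal Ordinal in
theorem exists_bound {c : Cardinal.{u}} (hc : c.IsRegular) (S : Set Ordinal.{u})
    (hS : #S < Cardinal.lift.{u + 1} c) (hlt : ∀ a ∈ S, a < c.ord) :
    ∃ γ < c.ord, ∀ a ∈ S, a < γ := by
  refine ⟨sSup ((· + 1) '' S), ?_, fun a ha => ?_⟩
  · refine sSup_add_one_lt_of_lt_cof ?_ hlt
    rwa [← lift_cof, hc.cof_ord]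
  · have hb : BddAbove ((· + 1) '' S) := by
      refine ⟨c.ord, ?_⟩
      rintro _ ⟨b, hb, rfl⟩
      exact Order.add_one_le_of_lt (hlt b hb)
    exact (lt_add_one a).trans_le (le_csSup hb ⟨a, ha, rfl⟩)

/-- The matrix whose entry at `(k, β)` is the hull of `β` with bound `g k`. The rows are indexed by
ordinals, of which only the natural numbers matter. -/
noncomputable def hullMatrix (W : Set ZFSet.{u}) [hW : Fact (IsInnerModel W)]
    (E : Ordinal.{u} → Ordinal.{u} → Ordinal.{u} → Prop) (g : ℕ → Ordinal.{u})
    (α β : Ordinal.{u}) : Set Ordinal.{u} := {ξ | Hull W E (g (Cardinal.toNat α.card)) β ξ}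

theorem hullMatrix_natCast (E : Ordinal.{u} → Ordinal.{u} → Ordinal.{u} → Prop)
    (g : ℕ → Ordinal.{u}) (k : ℕ) (β : Ordinal.{u}) :
    hullMatrix W E g k β = {ξ | Hull W E (g k) β ξ} := by
  simp [hullMatrix]

open Cardinal Ordinal in
theorem hullMatrix_upward {κ : Ordinal.{u}} {c : Cardinal.{u}}
    {E : Ordinal.{u} → Ordinal.{u} → Ordinal.{u} → Prop}
    (hE : ∀ β < c.ord, ∀ b < β, ∃ a < κ, E β a b)
    {g : ℕ → Ordinal.{u}} (hg : Monotone g) (hgκ : ∀ a < κ, ∃ k, a ≤ g k)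
    {γ β : Ordinal.{u}} (hγ : γ < β) (hβ : β < c.ord) (k : ℕ) :
    ∃ l : ℕ, {ξ | Hull W E (g k) γ ξ} ⊆ {ξ | Hull W E (g l) β ξ} := by
  obtain ⟨a, ha, haE⟩ := hE β hβ γ hγ
  obtain ⟨m, hm⟩ := hgκ a ha
  refine ⟨max k m, fun ξ hξ => ?_⟩
  exact (Hull.base hγ (hm.trans (hg (le_max_right _ _))) haE).trans
    (Hull.mono hξ (hg (le_max_left _ _)))

open Cardinal Ordinal in
/-- The coherence of the matrix is bought with `𝔠 < c`: a countable set has at most `𝔠` traces of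
hulls, so all of them occur below one index `γ < c.ord`. -/
theorem isCoveringMatrix_hullMatrix {κ : Ordinal.{u}} {c : Cardinal.{u}} (hc : c.IsRegular)
    (hc' : 𝔠 < c)
    {E : Ordinal.{u} → Ordinal.{u} → Ordinal.{u} → Prop}
    (hE : ∀ β < c.ord, ∀ b < β, ∃ a < κ, E β a b)
    {g : ℕ → Ordinal.{u}} (hg : Monotone g) (hgκ : ∀ a < κ, ∃ k, a ≤ g k) :
    Covering.IsCoveringMatrix ℵ₀ c (hullMatrix W E g) where
  subset α _ β hβ ξ hξ := (Hull.lt hξ).trans hβ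
  covers β hβ ξ hξ := by
    obtain ⟨a, ha, haE⟩ := hE β hβ ξ hξ
    obtain ⟨k, hk⟩ := hgκ a ha
    refine ⟨k, by simp, ?_⟩
    rw [hullMatrix_natCast]
    exact Hull.base hξ hk haE
  small α _ β hβ := by
    have h1 : hullMatrix W E g α β ⊆ Iio β := fun ξ hξ => Hull.lt hξ
    refine (mk_le_mk_of_subset h1).trans_lt ?_
    rw [Cardinal.mk_Iio_ordinal, Cardinal.lift_lt]
    exact Cardinal.lt_ord.1 hβ
  mono β _ α η hαη hη := by
    rw [Cardinal.ord_aleph0] at hη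
    obtain ⟨l, rfl⟩ := lt_omega0.1 hη
    obtain ⟨k, rfl⟩ := lt_omega0.1 (hαη.trans hη)
    rw [hullMatrix_natCast, hullMatrix_natCast]
    exact fun ξ hξ => Hull.mono hξ (hg (Nat.cast_le.1 hαη.le))
  upward γ β hγ hβ α hα := by
    rw [Cardinal.ord_aleph0] at hα
    obtain ⟨k, rfl⟩ := lt_omega0.1 hα
    obtain ⟨l, hl⟩ := hullMatrix_upward (W := W) hE hg hgκ hγ hβ k
    refine ⟨l, by simp, ?_⟩
    rwa [hullMatrix_natCast, hullMatrix_natCast]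
  coherent X hX hXc := by
    classical
    -- there are at most `𝔠` traces on `X` of entries of the matrix
    let p : Set Ordinal.{u} → Ordinal.{u} → Prop := fun Y β => β < c.ord ∧
      ∃ k : ℕ, Y = {ξ | Hull W E (g k) β ξ} ∩ X
    let b : Set Ordinal.{u} → Ordinal.{u} := fun Y => if h : ∃ β, p Y β then h.choose else 0
    have hb : ∀ Y, (∃ β, p Y β) → p Y (b Y) := fun Y h => by
      simp only [b, dif_pos h]
      exact h.choose_spec
    have hc0 : 0 < c.ord := by
      rw [Cardinal.lt_ord]; simpa using hc.pos
    have hb' : ∀ Y, b Y < c.ord := by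
      intro Y
      by_cases h : ∃ β, p Y β
      · exact (hb Y h).1
      · simp only [b, dif_neg h]
        exact hc0
    obtain ⟨γ, hγ, hγb⟩ := exists_bound hc (b '' 𝒫 X) (by
      refine (mk_image_le).trans_lt ?_
      rw [mk_powerset]
      refine (power_le_power_left two_ne_zero hXc).trans_lt ?_
      simpa using hc') (by rintro _ ⟨Y, -, rfl⟩; exact hb' Y)
    refine ⟨γ, hγ, fun β hβ η hη => ?_⟩
    rw [Cardinal.ord_aleph0] at hη
    obtain ⟨k, rfl⟩ := lt_omega0.1 hη
    have hex : ∃ β', p ({ξ | Hull W E (g k) β ξ} ∩ X) β' := ⟨β, hβ, k, rfl⟩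
    obtain ⟨h1, l, hl⟩ := hb _ hex
    obtain ⟨m, hm⟩ := hullMatrix_upward (W := W) hE hg hgκ
      (hγb _ ⟨_, inter_subset_right, rfl⟩) hγ l
    refine ⟨m, by simp, ?_⟩
    rw [hullMatrix_natCast, hullMatrix_natCast, hl]
    exact inter_subset_left.trans hm

open Cardinal Ordinal in
/-- The covering property yields an unbounded set `A` all of whose subsets of size at most `lam` are
included in hulls. For countable subsets this is the covering property itself; the indices of hulls
for the countable subsets of a set `X` of size `lam` have a common bound `γ`, and a hull of `γ`
includes `X`. -/
theorem exists_unbounded_of_CP {κ : Ordinal.{u}} {c : Cardinal.{u}} (hc : c.IsRegular)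
    (hc' : 𝔠 < c) (hCP : Covering.HasCP c ℵ₀)
    {E : Ordinal.{u} → Ordinal.{u} → Ordinal.{u} → Prop}
    (hE : ∀ β < c.ord, ∀ b < β, ∃ a < κ, E β a b)
    {g : ℕ → Ordinal.{u}} (hg : Monotone g) (hgκ : ∀ a < κ, ∃ k, a ≤ g k)
    {lam : Cardinal.{u}} (hlam : #(ℕ → Iio lam.ord) < Cardinal.lift.{u + 1} c) :
    ∃ A ⊆ Iio c.ord, (∀ β < c.ord, ∃ ξ ∈ A, β ≤ ξ) ∧
      ∀ X ⊆ A, #X ≤ Cardinal.lift.{u + 1} lam →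
        ∃ k : ℕ, ∃ β < c.ord, ∀ ξ ∈ X, Hull W E (g k) β ξ := by
  obtain ⟨A, hA, hAu, hAX⟩ := hCP _ (isCoveringMatrix_hullMatrix (W := W) hc hc' hE hg hgκ)
  refine ⟨A, hA, hAu, fun X hXA hX => ?_⟩
  have hinf : A.Infinite := by
    intro hfin
    obtain ⟨γ, hγ, hγA⟩ := exists_bound hc A
      ((lt_aleph0_iff_set_finite.2 hfin).trans_le (by simpa using hc.aleph0_le)) hA
    obtain ⟨ξ, hξ, hle⟩ := hAu γ hγ
    exact (hγA ξ hξ).not_ge hle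
  let t : ℕ ↪ A := hinf.natEmbedding
  -- the range of `σ` may be finite, whereas the covering property speaks of infinite sets: hence
  -- the added terms of `t`
  have hcov : ∀ σ : ℕ → X, ∃ k : ℕ, ∃ β < c.ord, ∀ i, Hull W E (g k) β (σ i) := by
    intro σ
    obtain ⟨α, hα, β, hβ, h⟩ := hAX (range (fun i => (σ i).1) ∪ range (fun i => (t i).1)) (by
      rintro _ (⟨i, rfl⟩ | ⟨i, rfl⟩)
      · exact hXA (σ i).2
      · exact (t i).2) (by
      rw [Cardinal.lift_aleph0]
      refine le_antisymm ?_ ?_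
      · rw [le_aleph0_iff_set_countable]
        exact (countable_range _).union (countable_range _)
      · refine (Cardinal.infinite_iff.1 ?_)
        refine Set.infinite_coe_iff.2 (Set.Infinite.mono subset_union_right ?_)
        exact infinite_range_of_injective (Subtype.val_injective.comp t.injective))
    rw [Cardinal.ord_aleph0] at hα
    obtain ⟨k, rfl⟩ := lt_omega0.1 hα
    rw [hullMatrix_natCast] at h
    exact ⟨k, β, hβ, fun i => h (Or.inl ⟨i, rfl⟩)⟩
  choose k b hb hkb using hcov
  obtain ⟨γ, hγ, hγb⟩ := exists_bound hc (range b) (by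
    refine mk_range_le.trans_lt (lt_of_le_of_lt ?_ hlam)
    have : #X ≤ #(Iio lam.ord) := by
      rw [Cardinal.mk_Iio_ordinal, card_ord]; exact hX
    obtain ⟨f⟩ := this
    exact Cardinal.mk_le_of_injective (f := fun (σ : ℕ → X) i => f (σ i))
      fun σ τ h => funext fun i => f.injective (congrFun h i)) (by rintro _ ⟨σ, rfl⟩; exact hb σ)
  -- if no entry with index `γ` included `X`, there would be a countable set that none includes
  by_contra! hcon
  choose x hx hxn using fun l => hcon l γ hγ
  obtain ⟨m, hm⟩ := hullMatrix_upward (W := W) hE hg hgκ (hγb _ ⟨fun i => ⟨x i, hx i⟩, rfl⟩) hγ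
    (k fun i => ⟨x i, hx i⟩)
  exact hxn m (hm (hkb (fun i => ⟨x i, hx i⟩) m))

/-! ### Cofinality and clubs in `W` -/

/-- Some strictly increasing function in `W` from `l` to `α` has cofinal range. For an infinite
regular cardinal `l` of the universe this implies that `α` has cofinality `l` in `W`. -/
def HasIncreasingMap (W : Set ZFSet.{u}) [hW : Fact (IsInnerModel W)] (l α : Ordinal.{u}) : Prop :=
  ∃ y : W, (∀ η < l, ∃ ζ < α, ∀ ζ', orel y η ζ' ↔ ζ' = ζ) ∧
    (∀ η < l, ∀ η' < l, η < η' → ∀ ζ ζ', orel y η ζ → orel y η' ζ' → ζ < ζ') ∧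
    ∀ ξ < α, ∃ η < l, ∃ ζ, orel y η ζ ∧ ξ ≤ ζ

instance Dfn.hasIncreasingMap (l : Ordinal.{u}) (a : (Fin n → W) → Ordinal.{u}) [OTm a] :
    Dfn (fun v => HasIncreasingMap W l (a v)) := by
  have : Dfn (W := W) (fun v : Fin 1 → W => HasIncreasingMap W l (InnerModel.ord (v 0))) := by
    unfold HasIncreasingMap
    infer_instance
  exact this.osubst₁ a

open Cardinal Ordinal in
theorem HasIncreasingMap.hasCofinalityIn {lam : Cardinal.{u}} (hlam : lam.IsRegular)
    {α : Ordinal.{u}} (h : HasIncreasingMap W lam.ord α) : HasCofinalityIn W α lam.ord := by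
  obtain ⟨y, hy, hmono, hcof⟩ := h
  choose! val hval hval' using hy
  constructor
  · obtain ⟨z, hz, hz'⟩ := exists_orel (W := W) lam.ord α (orel y) inferInstance
    have hz0 : ∀ η < lam.ord, ∀ ζ, orel z η ζ ↔ ζ = val η := by
      intro η hη ζ
      rw [hz', hval' η hη]
      exact ⟨fun h => h.2.2, fun h => ⟨hη, h ▸ hval η hη, h⟩⟩
    refine ⟨z.1, z.2, ⟨fun p hp => ?_, fun a ha => ?_⟩, fun ξ hξ => ?_⟩
    · obtain ⟨a, ha, b, hb, h⟩ := hz ⟨p, mem_of_mem z.2 hp⟩ hp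
      rw [Subtype.ext_iff] at h
      rw [show p = _ from h]
      exact ZFSet.pair_mem_prod.2 ⟨toZFSet_mem_toZFSet_iff.2 ha, toZFSet_mem_toZFSet_iff.2 hb⟩
    · obtain ⟨η, hη, rfl⟩ := mem_toZFSet_iff.1 ha
      refine ⟨(val η).toZFSet, (hz0 η hη _).2 rfl, fun w hw => ?_⟩
      obtain ⟨ζ, -, rfl⟩ : ∃ ζ : Ordinal.{u}, True ∧ ζ.toZFSet = w := by
        obtain ⟨a, -, b, -, h⟩ := hz ⟨_, mem_of_mem z.2 hw⟩ hw
        rw [Subtype.ext_iff] at h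
        exact ⟨b, trivial, (ZFSet.pair_inj.1 h).2.symm⟩
      rw [(hz0 η hη ζ).1 hw]
    · obtain ⟨η, hη, ζ, hζ, hle⟩ := hcof ξ hξ
      have := (hval' η hη ζ).1 hζ
      subst this
      exact ⟨η, hη, _, hval η hη, hle, (hz0 η hη _).2 rfl⟩
  · rintro γ ⟨f, -, ⟨hsub, hfun⟩, hfc⟩
    by_contra hlt
    rw [not_le] at hlt
    have hw : ∀ η < γ, ∃ i < lam.ord, ∀ ζ < α, ZFSet.pair η.toZFSet ζ.toZFSet ∈ f → ζ ≤ val i := by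
      intro η hη
      obtain ⟨w, hw, hu⟩ := hfun _ (toZFSet_mem_toZFSet_iff.2 hη)
      obtain ⟨ζ, hζ, rfl⟩ := mem_toZFSet_iff.1 (ZFSet.pair_mem_prod.1 (hsub hw)).2
      obtain ⟨i, hi, ζ', hζ', hle⟩ := hcof ζ hζ
      refine ⟨i, hi, fun ζ₁ _ h => ?_⟩
      rw [toZFSet_injective (hu _ h), ← (hval' i hi ζ').1 hζ']
      exact hle
    choose! i hi hiv using hw
    obtain ⟨δ, hδ, hδb⟩ := exists_bound hlam (i '' Iio γ) (by
      refine mk_image_le.trans_lt ?_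
      rw [Cardinal.mk_Iio_ordinal, Cardinal.lift_lt]
      exact Cardinal.lt_ord.1 hlt) (by rintro _ ⟨η, hη, rfl⟩; exact hi η hη)
    obtain ⟨η, hη, ζ, hζ, hle, hp⟩ := hfc (val δ) (hval δ hδ)
    have h1 := hδb _ ⟨η, hη, rfl⟩
    have h2 := hmono _ (hi η hη) _ hδ h1 _ _ ((hval' _ (hi η hη) _).2 rfl) ((hval' _ hδ _).2 rfl)
    exact (h2.trans_le hle).not_ge (hiv η hη ζ hζ hp)

open Cardinal Ordinal in
/-- The collapse of an unbounded subset of a regular cardinal is onto. -/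
theorem collapse_surjective {c : Cardinal.{u}} (hc : c.IsRegular) {P : Ordinal.{u} → Prop}
    {ρ : Ordinal.{u} → Ordinal.{u}} (hP : ∀ a, P a → a < c.ord)
    (hu : ∀ β < c.ord, ∃ a, P a ∧ β ≤ a) (hρ1 : ∀ a b, P a → P b → a < b → ρ a < ρ b)
    (hρ2 : ∀ b, P b → ∀ γ < ρ b, ∃ a < b, P a ∧ ρ a = γ) {γ : Ordinal.{u}} (hγ : γ < c.ord) :
    ∃ a, P a ∧ ρ a = γ := by
  by_contra! hcon
  have hlt : ∀ a, P a → ρ a < γ := by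
    intro a ha
    by_contra hle
    rcases (not_lt.1 hle).eq_or_lt with h | h
    · exact hcon a ha h.symm
    · obtain ⟨b, -, hb, h'⟩ := hρ2 a ha γ h
      exact hcon b hb h'
  obtain ⟨δ, hδ, hδb⟩ := exists_bound hc {a | P a} (by
    refine lt_of_le_of_lt ?_ (Cardinal.lift_lt.2 (Cardinal.lt_ord.1 hγ))
    rw [← Cardinal.mk_Iio_ordinal]
    refine Cardinal.mk_le_of_injective (f := fun a : {a | P a} => (⟨ρ a.1, hlt a.1 a.2⟩ : Iio γ))
      fun a b h => ?_
    have h' : ρ a = ρ b := Subtype.ext_iff.1 h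
    rcases lt_trichotomy a.1 b.1 with h1 | h1 | h1
    · exact ((hρ1 _ _ a.2 b.2 h1).ne h').elim
    · exact Subtype.ext h1
    · exact ((hρ1 _ _ b.2 a.2 h1).ne h'.symm).elim) hP
  obtain ⟨a, ha, hle⟩ := hu δ hδ
  exact (hδb a ha).not_ge hle

/-- A first-order rendering over `W` of "`C` is a club subset of `δ`". -/
def IsClubIn (δ : Ordinal.{u}) (C : W) : Prop :=
  (∀ z : W, z.1 ∈ C.1 → ∃ α < δ, z = toW W α) ∧ (∀ β < δ, ∃ ξ < δ, omem C ξ ∧ β ≤ ξ) ∧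
    ∀ ξ < δ, 0 < ξ → (∀ η < ξ, ∃ ζ < ξ, omem C ζ ∧ η < ζ) → omem C ξ

instance Dfn.isClubIn (δ : Ordinal.{u}) (C : (Fin n → W) → W) [Tm C] :
    Dfn (fun v => IsClubIn δ (C v)) := by
  have : Dfn (W := W) (fun v : Fin 1 → W => IsClubIn δ (v 0)) := by
    unfold IsClubIn
    infer_instance
  exact this.subst₁ C

/-- Being a club is absolute. -/
theorem isClubIn_iff {δ : Ordinal.{u}} {C : W} :
    IsClubIn δ C ↔ C.1 ⊆ δ.toZFSet ∧ IsClub (trace δ C.1) := by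
  have h0 : (∀ z : W, z.1 ∈ C.1 → ∃ α < δ, z = toW W α) ↔ C.1 ⊆ δ.toZFSet := by
    constructor
    · intro h z hz
      obtain ⟨α, hα, h⟩ := h ⟨z, mem_of_mem C.2 hz⟩ hz
      rw [Subtype.ext_iff] at h
      exact Ordinal.mem_toZFSet_iff.2 ⟨α, hα, h.symm⟩
    · intro h z hz
      exact eq_toW_of_mem (α := δ) (h hz)
  have h1 : (∀ β < δ, ∃ ξ < δ, omem C ξ ∧ β ≤ ξ) ↔ IsCofinal (trace δ C.1) := by
    constructor
    · rintro h ⟨β, hβ⟩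
      obtain ⟨ξ, hξ, hC, hle⟩ := h β hβ
      exact ⟨⟨ξ, hξ⟩, hC, hle⟩
    · intro h β hβ
      obtain ⟨⟨ξ, hξ⟩, hC, hle⟩ := h ⟨β, hβ⟩
      exact ⟨ξ, hξ, hC, hle⟩
  have h2 : (∀ ξ < δ, 0 < ξ → (∀ η < ξ, ∃ ζ < ξ, omem C ζ ∧ η < ζ) → omem C ξ) ↔
      DirSupClosed (trace δ C.1) := by
    constructor
    · rintro h d hd ⟨b, hb⟩ - ⟨a, ha⟩ hlub
      by_cases had : ⟨a, ha⟩ ∈ d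
      · exact hd had
      · have hlt : ∀ x ∈ d, x.1 < a := fun x hx =>
          lt_of_le_of_ne (hlub.1 hx) fun h => had (by
            have : x = ⟨a, ha⟩ := Subtype.ext h
            exact this ▸ hx)
        refine h a ha (pos_of_gt (hlt b hb)) fun η hη => ?_
        obtain ⟨x, hx, hηx⟩ := (lt_isLUB_iff hlub).1
          (show (⟨η, hη.trans ha⟩ : Iio δ) < ⟨a, ha⟩ from hη)
        exact ⟨x.1, hlt x hx, hd hx, hηx⟩
    · intro h ξ hξ h0 hη
      refine h (d := {x | x ∈ trace δ C.1 ∧ x.1 < ξ}) (a := ⟨ξ, hξ⟩) (fun x hx => hx.1) ?_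
        (.of_linearOrder _) ⟨fun x hx => hx.2.le, fun b hb => ?_⟩
      · obtain ⟨ζ, hζ, hζC, -⟩ := hη 0 h0
        exact ⟨⟨ζ, hζ.trans hξ⟩, hζC, hζ⟩
      · by_contra hlt
        obtain ⟨ζ, hζ, hζC, hb'⟩ := hη b.1 (not_le.1 hlt)
        exact (hb (show (⟨ζ, hζ.trans hξ⟩ : Iio δ) ∈ _ from ⟨hζC, hζ⟩)).not_gt hb'
  rw [IsClubIn, h0, h1, h2, isClub_iff, and_comm (a := IsCofinal _)]

open Cardinal Ordinal in
/-- The points of cofinality `lam` in `W`, in the guise of those with an increasing cofinal map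
from `lam`, meet every club in `W`: the supremum of the first `lam` elements of the club is such a
point. -/
theorem exists_mem_club_hasIncreasingMap {c : Cardinal.{u}} (hc : c.IsRegular)
    {lam : Cardinal.{u}} (hlam : ℵ₀ ≤ lam) (hlc : lam < c) {C : W} (hC : IsClubIn c.ord C) :
    ∃ α < c.ord, omem C α ∧ HasIncreasingMap W lam.ord α := by
  have hCo : ∀ α, omem C α → α < c.ord := fun α hα => by
    obtain ⟨β, hβ, h⟩ := hC.1 _ hα
    rwa [toW_inj.1 h]
  obtain ⟨ρ, hρ, hρ1, hρ2⟩ := exists_collapse W c.ord (omem C) inferInstance hCo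
  have hsurj : ∀ γ < c.ord, ∃ a, omem C a ∧ ρ a = γ := fun γ hγ =>
    collapse_surjective hc hCo (fun β hβ => by
      obtain ⟨ξ, -, h⟩ := hC.2.1 β hβ
      exact ⟨ξ, h⟩) hρ1 hρ2 hγ
  have hlc' : lam.ord < c.ord := Cardinal.ord_lt_ord.2 hlc
  choose! x hxC hxρ using hsurj
  have hx : ∀ i < lam.ord, ∀ j < lam.ord, i < j → x i < x j := by
    intro i hi j hj hij
    by_contra hle
    rcases (not_lt.1 hle).eq_or_lt with h | h
    · have := congrArg ρ h
      rw [hxρ _ (hi.trans hlc'), hxρ _ (hj.trans hlc')] at this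
      exact hij.ne' this
    · have := hρ1 _ _ (hxC _ (hj.trans hlc')) (hxC _ (hi.trans hlc')) h
      rw [hxρ _ (hi.trans hlc'), hxρ _ (hj.trans hlc')] at this
      exact hij.not_gt this
  have hlim : ∀ i < lam.ord, i + 1 < lam.ord := fun i hi =>
    (Cardinal.isSuccLimit_ord hlam).add_one_lt hi
  obtain ⟨γ, hγ, hγb⟩ := exists_bound hc (x '' Iio lam.ord) (by
    refine mk_image_le.trans_lt ?_
    rw [Cardinal.mk_Iio_ordinal, Cardinal.lift_lt, card_ord]
    exact hlc) (by rintro _ ⟨i, hi, rfl⟩; exact hCo _ (hxC _ (hi.trans hlc')))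
  let α := sInf {β | ∀ i < lam.ord, x i < β}
  have hγα : γ ∈ {β | ∀ i < lam.ord, x i < β} := fun i hi => hγb _ ⟨i, hi, rfl⟩
  have hxα : ∀ i < lam.ord, x i < α := csInf_mem (s := {β | ∀ i < lam.ord, x i < β}) ⟨γ, hγα⟩
  have hαγ : α ≤ γ := csInf_le' hγα
  have hcof : ∀ η < α, ∃ i < lam.ord, η < x i := by
    intro η hη
    have := notMem_of_lt_csInf' hη
    simp only [mem_ofPred_eq, not_forall, not_lt] at this
    obtain ⟨i, hi, hle⟩ := this
    exact ⟨i + 1, hlim i hi, hle.trans_lt (hx _ hi _ (hlim i hi) (lt_add_one i))⟩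
  have h0 : 0 < lam.ord := by rw [Cardinal.lt_ord]; simpa using aleph0_pos.trans_le hlam
  refine ⟨α, hαγ.trans_lt hγ, hC.2.2 α (hαγ.trans_lt hγ) (pos_of_gt (hxα 0 h0)) fun η hη => ?_, ?_⟩
  · obtain ⟨i, hi, h⟩ := hcof η hη
    exact ⟨x i, hxα i hi, hxC i (hi.trans hlc'), h⟩
  · have iρ : ∀ {n : ℕ} (t s : (Fin n → W) → Ordinal.{u}) [OTm t] [OTm s],
      Dfn (fun v => omem C (t v) ∧ s v = ρ (t v)) := fun t s _ _ =>
      Dfn.osubst₂ (P := fun a b => omem C a ∧ b = ρ a) hρ t s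
    obtain ⟨y, -, hy⟩ := exists_orel (W := W) lam.ord α (fun a b => omem C b ∧ a = ρ b)
      (iρ (fun v => ord (v 1)) (fun v => ord (v 0)))
    have hinj : ∀ a b, omem C a → omem C b → ρ a = ρ b → a = b := by
      intro a b ha hb h
      rcases lt_trichotomy a b with h1 | h1 | h1
      · exact ((hρ1 _ _ ha hb h1).ne h).elim
      · exact h1
      · exact ((hρ1 _ _ hb ha h1).ne h.symm).elim
    have hy' : ∀ i < lam.ord, ∀ b, orel y i b ↔ b = x i := by
      intro i hi b
      rw [hy]
      constructor
      · rintro ⟨-, -, hb, h⟩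
        exact hinj _ _ hb (hxC _ (hi.trans hlc')) (by rw [← h, hxρ _ (hi.trans hlc')])
      · rintro rfl
        exact ⟨hi, hxα i hi, hxC _ (hi.trans hlc'), (hxρ _ (hi.trans hlc')).symm⟩
    refine ⟨y, fun i hi => ⟨x i, hxα i hi, hy' i hi⟩, ?_, ?_⟩
    · intro i hi j hj hij ζ ζ' h h'
      rw [(hy' i hi ζ).1 h, (hy' j hj ζ').1 h']
      exact hx i hi j hj hij
    · intro ξ hξ
      obtain ⟨i, hi, h⟩ := hcof ξ hξ
      exact ⟨i, hi, x i, (hy' i hi _).2 rfl, h.le⟩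

/-! ### Stationary sets -/

open Cardinal Ordinal in
/-- The limit points of an unbounded subset of a regular uncountable cardinal form a club. -/
theorem isClub_limitPoints {c : Cardinal.{u}} (hc : c.IsRegular) (hc' : ℵ₀ < c)
    {A : Set Ordinal.{u}} (hA : A ⊆ Iio c.ord) (hu : ∀ β < c.ord, ∃ ξ ∈ A, β ≤ ξ) :
    IsClub {β : Iio c.ord | ∀ η < β.1, ∃ ξ ∈ A, η ≤ ξ ∧ ξ < β.1} := by
  have hlim : ∀ i < c.ord, i + 1 < c.ord := fun i hi =>
    (Cardinal.isSuccLimit_ord hc'.le).add_one_lt hi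
  constructor
  · rintro d hd - - ⟨a, ha⟩ hlub η hη
    obtain ⟨x, hx, hηx⟩ := (lt_isLUB_iff hlub).1
      (show (⟨η, hη.trans ha⟩ : Iio c.ord) < ⟨a, ha⟩ from hη)
    obtain ⟨ξ, hξ, h1, h2⟩ := hd hx η hηx
    exact ⟨ξ, hξ, h1, h2.trans_le (hlub.1 hx)⟩
  · rintro ⟨β, hβ⟩
    choose! f hfA hf using hu
    let a : ℕ → Ordinal.{u} := fun k => Nat.rec (f β) (fun _ x => f (x + 1)) k
    have haA : ∀ k, a k ∈ A := by
      intro k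
      induction k with
      | zero => exact hfA β hβ
      | succ k ih => exact hfA _ (hlim _ (hA ih))
    have hlt : ∀ k, a k < a (k + 1) := fun k =>
      (lt_add_one (a k)).trans_le (hf _ (hlim _ (hA (haA k))))
    obtain ⟨γ, hγ, hγb⟩ := exists_bound hc (range a) (by
      refine lt_of_le_of_lt ((le_aleph0_iff_set_countable).2 (countable_range a)) ?_
      rwa [Cardinal.aleph0_lt_lift]) (by rintro _ ⟨k, rfl⟩; exact hA (haA k))
    have hγm : γ ∈ {δ | ∀ k, a k < δ} := fun k => hγb _ ⟨k, rfl⟩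
    have hm : ∀ k, a k < sInf {δ | ∀ k, a k < δ} := csInf_mem (s := {δ | ∀ k, a k < δ}) ⟨γ, hγm⟩
    refine ⟨⟨sInf {δ | ∀ k, a k < δ}, (csInf_le' hγm).trans_lt hγ⟩, fun η hη => ?_,
      (hf β hβ).trans (hm 0).le⟩
    have := notMem_of_lt_csInf' hη
    simp only [mem_ofPred_eq, not_forall, not_lt] at this
    obtain ⟨k, hk⟩ := this
    exact ⟨a k, haA k, hk, hm k⟩

open Cardinal Ordinal in
/-- Ulam's argument: if `E β` is a partial function of `κ` onto `β` for all `β` below the regular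
cardinal `c > κ`, then each stationary set has, for some `i < κ` and unboundedly many `α`, a
stationary subset on which `E β i = α`. -/
theorem exists_ulam {c : Cardinal.{u}} (hc : c.IsRegular) (hc' : ℵ₀ < c) {κ : Ordinal.{u}}
    (hκ : κ.card < c) {E : Ordinal.{u} → Ordinal.{u} → Ordinal.{u} → Prop}
    (hE : ∀ β < c.ord, ∀ b < β, ∃ a < κ, E β a b) {S : Set (Iio c.ord)} (hS : IsStationary S) :
    ∃ i < κ, ∀ γ < c.ord, ∃ α, γ ≤ α ∧ α < c.ord ∧
      IsStationary {β : Iio c.ord | β ∈ S ∧ α < β.1 ∧ E β.1 i α} := by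
  have hcof : Order.cof (Iio c.ord) = Cardinal.lift.{u + 1} c := by
    rw [cof_Iio, ← lift_cof, hc.cof_ord]
  have hcof' : Order.cof (Iio c.ord) ≠ ℵ₀ := by
    rw [hcof]
    exact (Cardinal.aleph0_lt_lift.2 hc').ne'
  have hlim : ∀ i < c.ord, i + 1 < c.ord := fun i hi =>
    (Cardinal.isSuccLimit_ord hc'.le).add_one_lt hi
  have h1 : ∀ α < c.ord, ∃ i < κ,
      IsStationary {β : Iio c.ord | β ∈ S ∧ α < β.1 ∧ E β.1 i α} := by
    intro α hα
    have hsub : S ⊆ Iic ⟨α, hα⟩ ∪ ⋃ i : Iio κ, {β : Iio c.ord | β ∈ S ∧ α < β.1 ∧ E β.1 i α} := by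
      intro β hβ
      rcases le_or_gt β.1 α with h | h
      · exact Or.inl h
      · obtain ⟨i, hi, hiE⟩ := hE β.1 β.2 α h
        exact Or.inr (mem_iUnion.2 ⟨⟨i, hi⟩, hβ, h, hiE⟩)
    rcases (isStationary_union_iff hcof').1 (hS.mono hsub) with h | h
    · exfalso
      have hclub : IsClub (Ioi (⟨α, hα⟩ : Iio c.ord)) := by
        constructor
        · rintro d hd ⟨b, hb⟩ - a ha
          exact lt_of_lt_of_le (hd hb) (ha.1 hb)
        · rintro ⟨β, hβ⟩
          exact ⟨⟨max β (α + 1), max_lt hβ (hlim _ hα)⟩, (lt_add_one α).trans_le (le_max_right _ _),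
            le_max_left β (α + 1)⟩
      obtain ⟨x, hx, hx'⟩ := h hclub
      exact (lt_irrefl _ (lt_of_lt_of_le (show (⟨α, hα⟩ : Iio c.ord) < x from hx')
        (show x ≤ ⟨α, hα⟩ from hx)))
    · obtain ⟨i, hi⟩ := (isStationary_iUnion_iff hcof' (by
        rw [hcof, Cardinal.mk_Iio_ordinal]
        simpa only [Cardinal.lift_lift, Cardinal.lift_lt] using hκ)).1 h
      exact ⟨i.1, i.2, hi⟩
  by_contra! hcon
  choose! γ hγ hγn using hcon
  obtain ⟨δ, hδ, hδb⟩ := exists_bound hc (γ '' Iio κ) (by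
    refine mk_image_le.trans_lt ?_
    rwa [Cardinal.mk_Iio_ordinal, Cardinal.lift_lt]) (by rintro _ ⟨i, hi, rfl⟩; exact hγ i hi)
  obtain ⟨i, hi, hst⟩ := h1 δ hδ
  exact hγn i hi δ (hδb _ ⟨i, hi, rfl⟩).le hδ hst

open Cardinal Ordinal in
/-- Were every `W`-stationary set of points of `W`-cofinality `lam` stationary, then every
sequence in `κ` would be definable over `W`. -/
theorem exists_isStationaryIn_not_isStationary (hCP : Covering.CP.{u}) {κ : Ordinal.{u}}
    {s : ℕ → Ordinal.{u}} (hsκ : ∀ k, s k < κ) (hs : ¬ DfnSeq W s)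
    (hsucc : IsSuccCardinalIn W κ (Order.succ κ.card).ord)
    (hc : Cardinal.continuum.ord < κ)
    (hbelow : ∀ μ < κ, ∀ x ⊆ μ.toZFSet, x.card = ℵ₀ → x ∈ W)
    {lam : Cardinal.{u}} (hlam : lam.IsRegular) (hlamκ : lam.ord < κ) :
    ∃ S : ZFSet.{u}, IsStationaryIn W (Order.succ κ.card).ord S ∧
      (∀ α : Ordinal.{u}, α.toZFSet ∈ S → HasCofinalityIn W α lam.ord) ∧
      ¬ IsStationary (trace (Order.succ κ.card).ord S) := by
  by_contra! hcon
  have hcκ : 𝔠 ≤ κ.card := by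
    have := Ordinal.card_le_card hc.le
    rwa [card_ord] at this
  have hωκ : ω < κ := by
    refine lt_of_le_of_lt ?_ hc
    rw [← Cardinal.ord_aleph0]
    exact Cardinal.ord_le_ord.2 Cardinal.aleph0_le_continuum
  have hreg : (Order.succ κ.card).IsRegular :=
    Cardinal.isRegular_succ (Cardinal.aleph0_le_continuum.trans hcκ)
  have hκc : κ.card < Order.succ κ.card := Order.lt_succ _
  have h𝔠c : 𝔠 < Order.succ κ.card := hcκ.trans_lt hκc
  have hκc' : κ < (Order.succ κ.card).ord := hsucc.1.1
  have hωc : ℵ₀ < Order.succ κ.card := Cardinal.aleph0_lt_continuum.trans h𝔠c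
  have hlamc : lam < Order.succ κ.card :=
    Cardinal.ord_lt_ord.1 (hlamκ.trans hκc')
  obtain ⟨E, hEd, hEf, hE⟩ := exists_enumerations hsucc
  generalize Order.succ κ.card = c at *
  have iE : ∀ {n : ℕ} (t s r : (Fin n → W) → Ordinal.{u}) [OTm t] [OTm s] [OTm r],
    Dfn (fun v => E (t v) (s v) (r v)) := fun t s r _ _ _ => hEd.osubst₃ t s r
  -- the new sequence is cofinal in `κ`
  have hscof : ∀ a < κ, ∃ k, a ≤ s k := by
    intro a ha
    by_contra! h
    exact hs (dfnSeq_of_lt (le_max_right a ω) (hbelow _ (max_lt ha hωκ)) s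
      fun k => (h k).trans_le (le_max_left _ _))
  -- a monotone cofinal sequence of infinite ordinals in `κ`
  let g : ℕ → Ordinal.{u} := fun k => (Finset.range (k + 1)).sup s ⊔ ω
  have hg : Monotone g := fun k l hkl =>
    sup_le_sup_right (Finset.sup_mono (Finset.range_mono (by lia))) _
  have hgκ : ∀ k, g k < κ := fun k =>
    max_lt ((Finset.sup_lt_iff (bot_le.trans_lt hωκ)).2 fun l _ => hsκ l) hωκ
  have hgω : ∀ k, ω ≤ g k := fun k => le_sup_right
  have hgcof : ∀ a < κ, ∃ k, a ≤ g k := by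
    intro a ha
    obtain ⟨k, hk⟩ := hscof a ha
    exact ⟨k, hk.trans ((Finset.le_sup (Finset.self_mem_range_succ k)).trans le_sup_left)⟩
  have hseq : #(ℕ → Iio lam.ord) < Cardinal.lift.{u + 1} c := by
    refine (mk_seq_le (κ := κ) ?_ (hbelow _ hlamκ) hsκ hs).trans_lt (Cardinal.lift_lt.2 hκc)
    rw [← Cardinal.ord_aleph0]
    exact Cardinal.ord_le_ord.2 hlam.aleph0_le
  obtain ⟨A, hA, hAu, hAX⟩ := exists_unbounded_of_CP (W := W) hreg h𝔠c (hCP c hreg h𝔠c) hE hg hgcof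
    hseq
  -- a set of `W` that is stationary in `W` and consists of points of cofinality `lam` is stationary
  have key : ∀ P : Ordinal.{u} → Prop, Dfn (W := W) (fun v : Fin 1 → W => P (ord (v 0))) →
      (∀ α, P α → HasIncreasingMap W lam.ord α) →
      (∀ C : W, IsClubIn c.ord C → ∃ α < c.ord, omem C α ∧ P α) →
      IsStationary {β : Iio c.ord | P β.1} := by
    intro P hP hPl hPC
    obtain ⟨S, hS, hS'⟩ := exists_oset c.ord P hP
    have hSt : trace c.ord S.1 = {β : Iio c.ord | P β.1} := by
      ext β
      exact (hS' β.1).trans (and_iff_right β.2)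
    rw [← hSt]
    refine hcon S.1 ⟨S.2, hS, fun C hC hCs hCc => ?_⟩ fun α hα =>
      (hPl α ((hS' α).1 hα).2).hasCofinalityIn hlam
    obtain ⟨α, hα, hαC, hPα⟩ := hPC ⟨C, hC⟩ (isClubIn_iff.2 ⟨hCs, hCc⟩)
    exact ⟨⟨α, hα⟩, (hS' α).2 ⟨hα, hPα⟩, hαC⟩
  have hS0 : IsStationary {β : Iio c.ord | HasIncreasingMap W lam.ord β.1} :=
    key _ inferInstance (fun α h => h)
      fun C hC => exists_mem_club_hasIncreasingMap hreg hlam.aleph0_le hlamc hC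
  obtain ⟨i, hi, hiu⟩ := exists_ulam hreg hωc hκc hE hS0
  -- the Ulam sets `U α`, and the class `T` of those `α` for which `U α` is stationary in `W`; `T`
  -- is definable over `W`, and it is unbounded, so that its collapse `ρ` maps it onto `c.ord`
  let U : Ordinal.{u} → Ordinal.{u} → Prop := fun α β =>
    HasIncreasingMap W lam.ord β ∧ α < β ∧ E β i α
  let T : Ordinal.{u} → Prop := fun α => α < c.ord ∧
    ∀ C : W, IsClubIn c.ord C → ∃ β < c.ord, omem C β ∧ U α β
  have hTd : Dfn (W := W) (fun v : Fin 1 → W => T (ord (v 0))) := by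
    simp only [T, U]
    infer_instance
  have hTu : ∀ γ < c.ord, ∃ α, T α ∧ γ ≤ α := by
    intro γ hγ
    obtain ⟨α, hγα, hα, hst⟩ := hiu γ hγ
    refine ⟨α, ⟨hα, fun C hC => ?_⟩, hγα⟩
    obtain ⟨β, hβ, hβC⟩ := hst (isClubIn_iff.1 hC).2
    exact ⟨β.1, β.2, hβC, hβ⟩
  obtain ⟨ρ, hρd, hρ1, hρ2⟩ := exists_collapse W c.ord T hTd fun α h => h.1
  have iρ : ∀ {n : ℕ} (t s : (Fin n → W) → Ordinal.{u}) [OTm t] [OTm s],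
      Dfn (fun v => T (t v) ∧ s v = ρ (t v)) := fun t s _ _ =>
      Dfn.osubst₂ (P := fun a b => T a ∧ b = ρ a) hρd t s
  have hα : ∀ k, ∃ α, T α ∧ ρ α = s k := fun k =>
    collapse_surjective hreg (fun α h => h.1) hTu hρ1 hρ2 ((hsκ k).trans hκc')
  choose α hαT hαs using hα
  -- `s k` is the collapse of `α k`; each `U (α k)` is stationary and so has a limit point of `A`
  have hβ : ∀ k, ∃ β : Iio c.ord, U (α k) β.1 ∧ ∀ η < β.1, ∃ ξ ∈ A, η ≤ ξ ∧ ξ < β.1 := by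
    intro k
    have hst : IsStationary {β : Iio c.ord | U (α k) β.1} :=
      key _ (by simp only [U]; infer_instance) (fun β h => h.1) (hαT k).2
    obtain ⟨β, hβU, hβA⟩ := hst (isClub_limitPoints hreg hωc hA hAu)
    exact ⟨β, hβU, hβA⟩
  choose β hβU hβA using hβ
  -- a subset of `A` of size at most `lam` that is cofinal in all `β k`
  have hX : ∃ X ⊆ A, #X ≤ Cardinal.lift.{u + 1} lam ∧ (∀ k, ∃ ξ ∈ X, (β k).1 ≤ ξ) ∧
      ∀ k, ∀ η < (β k).1, ∃ ξ ∈ X, η ≤ ξ ∧ ξ < (β k).1 := by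
    have hf : ∀ k, ∃ f : Iio lam.ord → Ordinal.{u}, (∀ j, f j ∈ A ∧ f j < (β k).1) ∧
        ∀ η < (β k).1, ∃ j, η ≤ f j := by
      intro k
      obtain ⟨y, hy, -, hyc⟩ := (hβU k).1
      choose! v hv hv' using hy
      choose! f hfA hf hf' using hβA k
      refine ⟨fun j => f (v j), fun j => ⟨hfA _ (hv j j.2), hf' _ (hv j j.2)⟩, fun η hη => ?_⟩
      obtain ⟨j, hj, ζ, hζ, hle⟩ := hyc η hη
      rw [(hv' j hj ζ).1 hζ] at hle
      exact ⟨⟨j, hj⟩, hle.trans (hf _ (hv j hj))⟩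
    choose f hf hfc using hf
    choose t htA ht using fun k => hAu (β k).1 (β k).2
    refine ⟨range (fun p : ℕ × Iio lam.ord => f p.1 p.2) ∪ range t, ?_, ?_, ?_, ?_⟩
    · rintro _ (⟨p, rfl⟩ | ⟨k, rfl⟩)
      · exact (hf _ _).1
      · exact htA k
    · have hl : ℵ₀ ≤ Cardinal.lift.{u + 1} lam := by simpa using hlam.aleph0_le
      refine (Cardinal.mk_union_le _ _).trans (Cardinal.add_le_of_le hl ?_ ?_)
      · refine Cardinal.mk_range_le.trans ?_
        rw [Cardinal.mk_prod, Cardinal.mk_Iio_ordinal, card_ord]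
        simp only [Cardinal.mk_nat, Cardinal.lift_aleph0, Cardinal.lift_lift]
        exact (Cardinal.aleph0_mul_eq hl).le
      · exact ((le_aleph0_iff_set_countable).2 (countable_range t)).trans hl
    · intro k
      exact ⟨t k, Or.inr ⟨k, rfl⟩, ht k⟩
    · intro k η hη
      obtain ⟨j, hj⟩ := hfc k η hη
      exact ⟨_, Or.inl ⟨(k, j), rfl⟩, hj, (hf k j).2⟩
  obtain ⟨X, hXA, hXc, hXt, hXl⟩ := hX
  obtain ⟨m, θ, hθ, hXK⟩ := hAX X hXA hXc
  have iH : ∀ {n : ℕ} (t s r : (Fin n → W) → Ordinal.{u}) [OTm t] [OTm s] [OTm r],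
    Dfn (fun v => Hull W E (t v) (s v) (r v)) := fun t s r _ _ _ => (dfn_hull hEd).osubst₃ t s r
  obtain ⟨F, hFd, hFf, hFs⟩ := (covered_add_one (W := W) (hgω m)).trans
    (covered_hull hEd hEf (hgω m) θ)
  have iF : ∀ {n : ℕ} (t s : (Fin n → W) → Ordinal.{u}) [OTm t] [OTm s],
      Dfn (fun v => F (t v) (s v)) := fun t s _ _ => hFd.osubst₂ t s
  -- the least element of the hull above `β k`, and its code
  have hξ : ∀ k, ∃ ξ, Hull W E (g m) θ ξ ∧ (β k).1 ≤ ξ ∧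
      ∀ ζ < ξ, Hull W E (g m) θ ζ → ζ < (β k).1 := by
    intro k
    obtain ⟨ξ, hξ, hle⟩ := hXt k
    have hm := csInf_mem (s := {ξ | Hull W E (g m) θ ξ ∧ (β k).1 ≤ ξ}) ⟨ξ, hXK ξ hξ, hle⟩
    refine ⟨_, hm.1, hm.2, fun ζ hζ h => ?_⟩
    by_contra hle
    exact notMem_of_lt_csInf' hζ ⟨h, not_lt.1 hle⟩
  choose ξ hξH hξβ hξm using hξ
  choose a ha haF using fun k => hFs _ (hξH k)
  have hda : DfnSeq W a := dfnSeq_of_lt (hgω m) (hbelow _ (hgκ m)) a ha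
  -- the sequence `a` in `g m` is definable, and `s` is decoded from it: from `a k` to `ξ k`,
  -- to `β k`, to `α k`, to `s k`; the hull is cofinal in `β k`, which is thus the supremum of the
  -- elements of the hull below `ξ k`
  refine hs (hda.map (fun x b => ∃ ξ, F x ξ ∧ ∃ β, ((∀ ζ < ξ, Hull W E (g m) θ ζ → ζ < β) ∧
    ∀ η < β, ∃ ζ < ξ, Hull W E (g m) θ ζ ∧ η ≤ ζ) ∧ ∃ α, E β i α ∧ (T α ∧ b = ρ α))
    inferInstance fun k b => ?_)
  have hβk : (∀ ζ < ξ k, Hull W E (g m) θ ζ → ζ < (β k).1) ∧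
      ∀ η < (β k).1, ∃ ζ < ξ k, Hull W E (g m) θ ζ ∧ η ≤ ζ := by
    refine ⟨hξm k, fun η hη => ?_⟩
    obtain ⟨ζ, hζ, h1, h2⟩ := hXl k η hη
    exact ⟨ζ, h2.trans_le (hξβ k), hXK ζ hζ, h1⟩
  constructor
  · rintro ⟨ξ', hξ', β', ⟨h1, h2⟩, α', hα', -, rfl⟩
    obtain rfl := hFf _ _ _ (haF k) hξ'
    have : β' = (β k).1 := by
      rcases lt_trichotomy β' (β k).1 with h | h | h
      · obtain ⟨ζ, hζ, hH, hle⟩ := hβk.2 _ h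
        exact ((h1 ζ hζ hH).not_ge hle).elim
      · exact h
      · obtain ⟨ζ, hζ, hH, hle⟩ := h2 _ h
        exact ((hβk.1 ζ hζ hH).not_ge hle).elim
    subst this
    rw [hEf _ _ _ _ hα' (hβU k).2.2, hαs]
  · rintro rfl
    exact ⟨ξ k, haF k, (β k).1, hβk, α k, (hβU k).2.2, hαT k, (hαs k).symm⟩

end InnerModel

/-- The universe `V` is `ZFSet.{u}`, and `(Order.succ κ.card).ord` is `κ^+` in `V`. -/
theorem mainTheorem10 (W : Set ZFSet.{u}) (hW : InnerModel.IsInnerModel W)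
    (hCP : Covering.CP.{u})
    (κ : Ordinal.{u})
    (hκ : IsLeast {μ : Ordinal.{u} |
      InnerModel.IsCardinalIn W μ ∧ InnerModel.HasNewSequence W μ} κ)
    (hsucc : InnerModel.IsSuccCardinalIn W κ (Order.succ κ.card).ord)
    (hc : Cardinal.continuum.ord < κ)
    (hbelow : ∀ μ < κ, ∀ x ⊆ μ.toZFSet, x.card = Cardinal.aleph0 → x ∈ W)
    (lam : Cardinal.{u}) (hlam : lam.IsRegular) (hlamκ : lam.ord < κ) :
    ∃ S : ZFSet.{u},
      InnerModel.IsStationaryIn W (Order.succ κ.card).ord S ∧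
      (∀ α : Ordinal.{u}, α.toZFSet ∈ S → InnerModel.HasCofinalityIn W α lam.ord) ∧
      ¬ IsStationary (InnerModel.trace (Order.succ κ.card).ord S) := by
  have : Fact (InnerModel.IsInnerModel W) := ⟨hW⟩
  obtain ⟨s, hsκ, hs⟩ := InnerModel.exists_seq_of_hasNewSequence hκ.1.2
  exact InnerModel.exists_isStationaryIn_not_isStationary hCP hsκ hs hsucc hc hbelow hlam hlamκ
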